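/- Let $\pi\colon E\to\mathbb R$ be a smooth fibre bundle with $\dim E=n+1$, let $\eta=dt$ be the volume form of $\mathbb R$, and let $k\ge 1$. Write $J^r\pi$ for the bundle of $r$-jets of sections of $\pi$, with induced coordinates $(t,q_0^A,\dots,q_r^A)$, $1\le A\le n$; let $J^{k-1}\pi^*=T^*(J^{k-1}\pi)/(\bar\pi^{k-1})^*T^*\mathbb R$, where $\bar\pi^{k-1}\colon J^{k-1}\pi\to\mathbb R$ is the projection, let $\mu\colon T^*(J^{k-1}\pi)\to J^{k-1}\pi^*$ be the quotient map, $\bar\tau\colon J^{k-1}\pi^*\to\mathbb R$ the projection, and $\Omega_{k-1}=-d\Theta_{k-1}$ the canonical symplectic form of $T^*(J^{k-1}\pi)$. Let $L\in C^\infty(J^k\pi)$, with associated Lagrangian density $L\,dt$. *Legendre maps.* The extended Legendre–Ostrogradsky map $\widetilde{\mathcal{FL}}\colon J^{2k-1}\pi\to T^*(J^{k-1}\pi)$, over $J^{k-1}\pi$, sends a jet to the covector $p\,dt+\sum_{r=0}^{k-1}p^r_A\,dq^A_r$ with $$p^{r}_A=\sum_{i=0}^{k-1-r}(-1)^i d_T^i\Big(\frac{\partial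 L}{\partial q^A_{r+1+i}}\Big),\qquad p=L-\sum_{r=0}^{k-1}p^r_A\,q^A_{r+1},$$ where $d_T$ is the total time derivative; the restricted map is $\mathcal{FL}=\mu\circ\widetilde{\mathcal{FL}}\colon J^{2k-1}\pi\to J^{k-1}\pi^*$. Assume that $L$ is hyperregular, i.e. that $\mathcal{FL}$ is a global diffeomorphism. *Unified formalism.* Let $W=J^{2k-1}\pi\times_{J^{k-1}\pi}T^*(J^{k-1}\pi)$, with projection $\rho_2$ to $T^*(J^{k-1}\pi)$, and put $\hat\rho_2=\mu\circ\rho_2\colon W\to J^{k-1}\pi^*$. The coupling function $\hat C$ on $W$ is $\hat C(j^{2k-1}_t\phi,\alpha)=\alpha\big(T_t(j^{k-1}\phi)(\partial/\partial t)\big)$. Let $W_o=\{w\in W:\hat C(w)=L(w)\}$, where $L$ is pulled back to $W$; let $\Omega_o$ be the restriction of $\rho_2^*\Omega_{k-1}$ to $W_o$, let $\rho^o_{\mathbb R}\colon W_o\to\mathbb R$ be the projection, and let $W_1\subset W_o$ be the graph of $\widetilde{\mathcal{FL}}$. A solution of the unified equations is a smooth vector field $X_o\in\mathfrak X_{W_1}(W_o)$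 in $W_o$, at support on $W_1$, with $$i(X_o)\Omega_o|_{W_1}=0,\qquad i(X_o)(\rho^o_{\mathbb R})^*\eta|_{W_1}=1 .$$ *Hamiltonian formalism.* For $a\in J^{k-1}\pi^*$ let $h(a)$ be the unique $\beta\in T^*(J^{k-1}\pi)$ with $\mu(\beta)=a$ and $(\mathcal{FL}^{-1}(a),\beta)\in W_o$; this gives a section $h$ of $\mu$. Put $\Omega_h=h^*\Omega_{k-1}$. A solution of the Hamiltonian equations is a smooth vector field $X_h$ on $J^{k-1}\pi^*$ with $$i(X_h)\Omega_h=0,\qquad i(X_h)\bar\tau^*\eta=1 .$$ **Theorem.** 1. If $X_o\in\mathfrak X_{W_1}(W_o)$ is a solution of the unified equations and is tangent to $W_1$, then there exists a unique vector field $X_h$ on $J^{k-1}\pi^*$ which is a solution of the Hamiltonian equations; moreover $X_h\circ\hat\rho_2=T\hat\rho_2\circ X_o$ on $W_1$. 2. Conversely, if $X_h$ is a solution of the Hamiltonian equations, then there exists a unique $X_o\in\mathfrak X_{W_1}(W_o)$ which is a solution of the unified equations and is tangent to $W_1$; moreover $X_h\circ\hat\rho_2=T\hat\rho_2\circ X_o$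 on $W_1$. -/

import Mathlib

open Set Filter Topology Manifold
open scoped ContDiff

noncomputable section

namespace HOMech

/-! ### Calculus in one real variable with parameters -/

section Calculus

lemma iteratedFDeriv_eq_of_iteratedDeriv_eq {V : Type*} [NormedAddCommGroup V] [NormedSpace ℝ V]
    {a b : ℝ → V} {t : ℝ} {i : ℕ} (h : iteratedDeriv i a t = iteratedDeriv i b t) :
    iteratedFDeriv ℝ i a t = iteratedFDeriv ℝ i b t := by
  rw [iteratedDeriv_eq_iteratedFDeriv, iteratedDeriv_eq_iteratedFDeriv] at h
  exact ContinuousMultilinearMap.ext_ring h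

lemma iteratedDeriv_comp_congr {V W : Type*} [NormedAddCommGroup V] [NormedSpace ℝ V]
    [NormedAddCommGroup W] [NormedSpace ℝ W] {G : V → W} {a b : ℝ → V} {t : ℝ} {k : ℕ}
    (hG : ContDiffAt ℝ ∞ G (a t)) (ha : ContDiffAt ℝ ∞ a t) (hb : ContDiffAt ℝ ∞ b t)
    (h : ∀ i ≤ k, iteratedDeriv i a t = iteratedDeriv i b t) :
    ∀ i ≤ k, iteratedDeriv i (G ∘ a) t = iteratedDeriv i (G ∘ b) t := by
  intro i hi
  have h0 : a t = b t := by simpa using h 0 (Nat.zero_le k)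
  have hle : ((i : ℕ) : WithTop ℕ∞) ≤ ∞ := by exact_mod_cast le_top
  rw [iteratedDeriv_eq_iteratedFDeriv, iteratedDeriv_eq_iteratedFDeriv,
    iteratedFDeriv_comp hG ha hle, iteratedFDeriv_comp (h0 ▸ hG) hb hle, ← h0]
  congr 1
  unfold FormalMultilinearSeries.taylorComp
  refine Finset.sum_congr rfl fun c _ => ?_
  unfold FormalMultilinearSeries.compAlongOrderedFinpartition
  congr 1
  funext m
  exact iteratedFDeriv_eq_of_iteratedDeriv_eq (h _ ((c.partSize_le m).trans hi))

lemma contDiffOn_iteratedDeriv_param {X F : Type*} [NormedAddCommGroup X] [NormedSpace ℝ X]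
    [NormedAddCommGroup F] [NormedSpace ℝ F] {g : X × ℝ → F} {O : Set (X × ℝ)} (hO : IsOpen O)
    (hg : ContDiffOn ℝ ∞ g O) (i : ℕ) :
    ContDiffOn ℝ ∞ (fun p : X × ℝ => iteratedDeriv i (fun s => g (p.1, s)) p.2) O := by
  induction i with
  | zero => simpa using hg
  | succ i ih =>
    have h1 : ContDiffOn ℝ ∞ (fun p : X × ℝ =>
        fderiv ℝ (fun p : X × ℝ => iteratedDeriv i (fun s => g (p.1, s)) p.2) p (0, 1)) O := by
      have := ih.fderiv_of_isOpen hO (m := ∞) (by simp)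
      exact this.clm_apply contDiffOn_const
    refine h1.congr fun p hp => ?_
    rw [iteratedDeriv_succ]
    have hd : DifferentiableAt ℝ
        (fun p : X × ℝ => iteratedDeriv i (fun s => g (p.1, s)) p.2) p :=
      ((ih p hp).contDiffAt (hO.mem_nhds hp)).differentiableAt (by simp)
    have hc : HasDerivAt (fun s : ℝ => (p.1, s)) ((0 : X), (1 : ℝ)) p.2 :=
      (hasDerivAt_const p.2 p.1).prodMk (hasDerivAt_id p.2)
    exact (hd.hasFDerivAt.comp_hasDerivAt p.2 hc).deriv

/-- The polynomial curve `s ↦ ∑ i, (s - t)^i / i! • q i`, with derivatives `q i` at `t`. -/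
def taylorCurve {n k : ℕ} (x : ℝ × (Fin (k + 1) → Fin n → ℝ)) (s : ℝ) : Fin n → ℝ :=
  ∑ i : Fin (k + 1), ((s - x.1) ^ (i : ℕ) / (Nat.factorial i : ℝ)) • x.2 i

lemma contDiff_taylorCurve {n k : ℕ} :
    ContDiff ℝ ∞ (fun p : (ℝ × (Fin (k + 1) → Fin n → ℝ)) × ℝ => taylorCurve p.1 p.2) := by
  unfold taylorCurve
  fun_prop

lemma contDiff_taylorCurve' {n k : ℕ} (x : ℝ × (Fin (k + 1) → Fin n → ℝ)) :
    ContDiff ℝ ∞ (taylorCurve x) := by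
  unfold taylorCurve
  fun_prop

lemma iteratedDeriv_taylorCurve {n k : ℕ} (x : ℝ × (Fin (k + 1) → Fin n → ℝ)) (j : Fin (k + 1)) :
    iteratedDeriv j (taylorCurve x) x.1 = x.2 j := by
  have h1 : ∀ i : Fin (k + 1), ContDiffAt ℝ ((j : ℕ) : WithTop ℕ∞)
      (fun s : ℝ => ((s - x.1) ^ (i : ℕ) / (Nat.factorial i : ℝ)) • x.2 i) x.1 := by
    intro i
    fun_prop
  have h2 : ∀ i : Fin (k + 1), iteratedDeriv j
      (fun s : ℝ => ((s - x.1) ^ (i : ℕ) / (Nat.factorial i : ℝ)) • x.2 i) x.1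
      = if i = j then x.2 j else 0 := by
    intro i
    rw [iteratedDeriv_smul_const (by fun_prop), iteratedDeriv_div_const,
      iteratedDeriv_comp_sub_const (j : ℕ) (fun z : ℝ => z ^ (i : ℕ))]
    simp only [sub_self, iteratedDeriv_fun_pow_zero]
    by_cases hij : i = j
    · subst hij
      have : (Nat.factorial (i : ℕ) : ℝ) ≠ 0 := by positivity
      simp [this]
    · have : ¬ ((j : ℕ) = (i : ℕ)) := fun h => hij (Fin.ext h.symm)
      simp [hij, this]
  unfold taylorCurve
  rw [iteratedDeriv_fun_sum fun i _ => h1 i]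
  simp [h2]

@[simp] lemma taylorCurve_self {n k : ℕ} (x : ℝ × (Fin (k + 1) → Fin n → ℝ)) :
    taylorCurve x x.1 = x.2 0 := by
  simpa using iteratedDeriv_taylorCurve x 0

lemma iteratedDeriv_prodMk {V W : Type*} [NormedAddCommGroup V] [NormedSpace ℝ V]
    [NormedAddCommGroup W] [NormedSpace ℝ W] {f : ℝ → V} {g : ℝ → W} {t : ℝ}
    (hf : ContDiffAt ℝ ∞ f t) (hg : ContDiffAt ℝ ∞ g t) (i : ℕ) :
    iteratedDeriv i (fun s => (f s, g s)) t = (iteratedDeriv i f t, iteratedDeriv i g t) := by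
  have hle : ((i : ℕ) : WithTop ℕ∞) ≤ ∞ := by exact_mod_cast le_top
  have hfg : ContDiffAt ℝ i (fun s => (f s, g s)) t := (hf.prodMk hg).of_le hle
  have h1 := (ContinuousLinearMap.fst ℝ V W).iteratedFDeriv_comp_left hfg le_rfl
  have h2 := (ContinuousLinearMap.snd ℝ V W).iteratedFDeriv_comp_left hfg le_rfl
  simp only [iteratedDeriv_eq_iteratedFDeriv]
  refine Prod.ext ?_ ?_
  · exact (congrArg (fun m => m fun _ => (1 : ℝ)) h1).symm
  · exact (congrArg (fun m => m fun _ => (1 : ℝ)) h2).symm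

end Calculus

/-! ### Fibred manifolds over the line and adapted charts -/

section Fibred

variable (n : ℕ) {E : Type*} [TopologicalSpace E]
  [ChartedSpace (EuclideanSpace ℝ (Fin (n + 1))) E]

/-- `π : E → ℝ` is a smooth fibred manifold with `dim E = n + 1`: a surjective submersion.
(Every locally trivial smooth bundle over `ℝ` is one.) -/
class IsFibredOverLine (π : E → ℝ) : Prop where
  surjective : Function.Surjective π
  isSubmersion : Manifold.IsSubmersion (𝓡 (n + 1)) 𝓘(ℝ, ℝ) ∞ π

/-- A local chart `(t, q^A)` of `E` adapted to `π`: its first coordinate is `t = π`. -/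
structure IsAdaptedChart (π : E → ℝ) (e : OpenPartialHomeomorph E (ℝ × (Fin n → ℝ))) : Prop where
  contMDiffOn : ContMDiffOn (𝓡 (n + 1)) 𝓘(ℝ, ℝ × (Fin n → ℝ)) ∞ e e.source
  contMDiffOn_symm : ContMDiffOn 𝓘(ℝ, ℝ × (Fin n → ℝ)) (𝓡 (n + 1)) ∞ e.symm e.target
  fst_eq : ∀ x ∈ e.source, (e x).1 = π x

variable {n}

lemma exists_isAdaptedChart (π : E → ℝ) [h : IsFibredOverLine n π] (x : E) :
    ∃ e, IsAdaptedChart n π e ∧ x ∈ e.source := by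
  obtain ⟨F, _, _, hF⟩ := h.isSubmersion
  have hx := hF x
  set φ := hx.domChart
  set ψ := hx.codChart
  have hfin : FiniteDimensional ℝ (ℝ × F) :=
    Module.Finite.equiv hx.equiv.toLinearEquiv
  have hfinF : FiniteDimensional ℝ F :=
    Module.Finite.of_surjective (LinearMap.snd ℝ ℝ F) LinearMap.snd_surjective
  have hrank : Module.finrank ℝ F = Module.finrank ℝ (Fin n → ℝ) := by
    have h1 := hx.equiv.toLinearEquiv.finrank_eq
    rw [Module.finrank_prod] at h1
    simp at h1
    simp
    omega
  let L : F ≃L[ℝ] (Fin n → ℝ) := ContinuousLinearEquiv.ofFinrankEq hrank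
  let A : EuclideanSpace ℝ (Fin (n + 1)) ≃L[ℝ] ℝ × (Fin n → ℝ) :=
    hx.equiv.trans ((ContinuousLinearEquiv.refl ℝ ℝ).prodCongr L)
  let e : OpenPartialHomeomorph E (ℝ × (Fin n → ℝ)) :=
    (φ ≫ₕ A.toHomeomorph.toOpenPartialHomeomorph) ≫ₕ
      (ψ.symm.prod (OpenPartialHomeomorph.refl (Fin n → ℝ)))
  have key : ∀ y ∈ φ.source, (A (φ y)).1 = ψ (π y) := by
    intro y hy
    have h1 : φ y ∈ (φ.extend (𝓡 (n + 1))).target := by simpa using φ.map_source hy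
    have h2 := hx.writtenInCharts h1
    have h3 : φ.symm (φ y) = y := φ.left_inv hy
    simp only [Function.comp_apply, OpenPartialHomeomorph.extend_coe_symm,
      OpenPartialHomeomorph.extend_coe, modelWithCornersSelf_coe, modelWithCornersSelf_coe_symm,
      id_eq] at h2
    rw [h3] at h2
    exact h2.symm
  have hψ : ∀ y ∈ φ.source, π y ∈ ψ.source := hx.source_subset_preimage_source
  have hs : e.source = φ.source := by
    ext y
    simp only [e, OpenPartialHomeomorph.trans_source, mem_inter_iff, mem_preimage]
    constructor
    · rintro ⟨⟨h1, -⟩, -⟩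
      exact h1
    · intro hy
      refine ⟨⟨hy, by simp⟩, ?_⟩
      simp [key y hy, ψ.map_source (hψ y hy)]
  have hφm := hx.domChart_mem_maximalAtlas
  have hψm := hx.codChart_mem_maximalAtlas
  have hφ1 := contMDiffOn_of_mem_maximalAtlas hφm
  have hφ2 := contMDiffOn_symm_of_mem_maximalAtlas hφm
  have hψ1 := contMDiffOn_of_mem_maximalAtlas hψm
  have hψ2 := contMDiffOn_symm_of_mem_maximalAtlas hψm
  refine ⟨e, ⟨?_, ?_, ?_⟩, ?_⟩
  · have hA : ContMDiffOn (𝓡 (n + 1)) 𝓘(ℝ, ℝ × (Fin n → ℝ)) ∞ (fun y => A (φ y)) e.source := by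
      rw [hs]
      exact A.contDiff.contMDiff.comp_contMDiffOn hφ1
    have h1 : ContMDiffOn (𝓡 (n + 1)) 𝓘(ℝ, ℝ) ∞ (fun y => ψ.symm (A (φ y)).1) e.source := by
      refine hψ2.comp (contDiff_fst.contMDiff.comp_contMDiffOn hA) ?_
      intro y hy
      rw [hs] at hy
      simpa [key y hy] using ψ.map_source (hψ y hy)
    exact h1.prodMk_space (contDiff_snd.contMDiff.comp_contMDiffOn hA)
  · have ht : ∀ z ∈ e.target, z.1 ∈ ψ.source ∧ A.symm (ψ z.1, z.2) ∈ φ.target := by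
      intro z hz
      simpa [e] using hz
    have h1 : ContMDiffOn 𝓘(ℝ, ℝ × (Fin n → ℝ)) 𝓘(ℝ, ℝ) ∞
        (fun z : ℝ × (Fin n → ℝ) => ψ z.1) e.target :=
      hψ1.comp contDiff_fst.contMDiff.contMDiffOn fun z hz => (ht z hz).1
    have h2 : ContMDiffOn 𝓘(ℝ, ℝ × (Fin n → ℝ)) (𝓡 (n + 1)) ∞
        (fun z : ℝ × (Fin n → ℝ) => A.symm (ψ z.1, z.2)) e.target :=
      A.symm.contDiff.contMDiff.comp_contMDiffOn
        (h1.prodMk_space contDiff_snd.contMDiff.contMDiffOn)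
    exact hφ2.comp h2 fun z hz => (ht z hz).2
  · intro y hy
    rw [hs] at hy
    change ψ.symm (A (φ y)).1 = π y
    rw [key y hy, ψ.left_inv (hψ y hy)]
  · rw [hs]
    exact hx.mem_domChart_source

end Fibred

/-! ### Jet bundles -/

section Jets

/-- The coordinate space `(t, q_0^A, …, q_k^A)` of the `k`-jets. -/
abbrev JetCoord (n k : ℕ) : Type := ℝ × (Fin (k + 1) → Fin n → ℝ)

variable (n : ℕ) {E : Type*} [TopologicalSpace E]
  [ChartedSpace (EuclideanSpace ℝ (Fin (n + 1))) E] (π : E → ℝ)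

/-- `φ` is, on a neighbourhood of `t`, a smooth section of `π`. -/
def IsLocalSection (φ : ℝ → E) (t : ℝ) : Prop :=
  ∀ᶠ s in 𝓝 t, ContMDiffAt 𝓘(ℝ, ℝ) (𝓡 (n + 1)) ∞ φ s ∧ π (φ s) = s

/-- A point `t` of the line together with a local section of `π` around `t`. -/
def PointedSection : Type _ := {p : ℝ × (ℝ → E) // IsLocalSection n π p.2 p.1}

variable {n} in
/-- The coordinates `(t, q_i^A = d^i φ^A / dt^i)` in the chart `e` of the `k`-jet of `φ` at `t`. -/
def sectionCoord (k : ℕ) (e : OpenPartialHomeomorph E (ℝ × (Fin n → ℝ))) (p : ℝ × (ℝ → E)) :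
    JetCoord n k :=
  (p.1, fun i => iteratedDeriv i (fun s => (e (p.2 s)).2) p.1)

/-- Two sections have the same `k`-jet at `t` if they take the same value at `t` and have the same
derivatives up to order `k` at `t` in adapted charts. -/
def jetSetoid (k : ℕ) : Setoid (PointedSection n π) where
  r p q := p.1.1 = q.1.1 ∧ p.1.2 p.1.1 = q.1.2 q.1.1 ∧
    ∀ e, IsAdaptedChart n π e → p.1.2 p.1.1 ∈ e.source →
      sectionCoord k e p.1 = sectionCoord k e q.1
  iseqv :=
    { refl := fun _ => ⟨rfl, rfl, fun _ _ _ => rfl⟩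
      symm := fun h => ⟨h.1.symm, h.2.1.symm, fun e he hs =>
        (h.2.2 e he (h.2.1.symm ▸ hs)).symm⟩
      trans := fun h h' => ⟨h.1.trans h'.1, h.2.1.trans h'.2.1, fun e he hs =>
        (h.2.2 e he hs).trans (h'.2.2 e he (h.2.1 ▸ hs))⟩ }

/-- The `k`-th order jet bundle `J^k π`: the `k`-jets of local sections of `π`. -/
def Jet (k : ℕ) : Type _ := Quotient (jetSetoid n π k)

namespace Jet

variable {n π} {k : ℕ}

/-- The projection `π̄^k : J^k π → ℝ`. -/
def time (j : Jet n π k) : ℝ :=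
  Quotient.lift (s := jetSetoid n π k) (fun p : PointedSection n π => p.1.1) (fun _ _ h => h.1) j

/-- The projection `π^k : J^k π → E`. -/
def point (j : Jet n π k) : E :=
  Quotient.lift (s := jetSetoid n π k) (fun p : PointedSection n π => p.1.2 p.1.1)
    (fun _ _ h => h.2.1) j

/-- The projection `π^k_r : J^k π → J^r π`, for `r ≤ k`. -/
def proj {r : ℕ} (hr : r ≤ k) (j : Jet n π k) : Jet n π r :=
  Quotient.map' (s₁ := jetSetoid n π k) (s₂ := jetSetoid n π r) id
    (fun p q h => ⟨h.1, h.2.1, fun e he hs => by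
      have := h.2.2 e he hs
      refine Prod.ext h.1 (funext fun i => ?_)
      exact congrFun (congrArg Prod.snd this) (Fin.castLE (by omega) i)⟩) j

/-- The coordinates of a jet in the chart `e`. -/
def coord (e : OpenPartialHomeomorph E (ℝ × (Fin n → ℝ))) (j : Jet n π k) : JetCoord n k :=
  sectionCoord k e (Quotient.out j).1

end Jet

variable {n π} {k : ℕ} {e e' : OpenPartialHomeomorph E (ℝ × (Fin n → ℝ))}

lemma PointedSection.eventually_mem (p : PointedSection n π) (hp : p.1.2 p.1.1 ∈ e.source) :
    ∀ᶠ s in 𝓝 p.1.1, p.1.2 s ∈ e.source :=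
  (p.2.self_of_nhds.1.continuousAt).eventually (e.open_source.mem_nhds hp)

lemma PointedSection.contDiffAt (he : IsAdaptedChart n π e) (p : PointedSection n π)
    (hp : p.1.2 p.1.1 ∈ e.source) : ContDiffAt ℝ ∞ (fun s => e (p.1.2 s)) p.1.1 := by
  have h1 := (he.contMDiffOn.contMDiffAt (e.open_source.mem_nhds hp)).comp p.1.1
    p.2.self_of_nhds.1
  exact h1.contDiffAt

/-- The change of the induced jet coordinates from the chart `e` to the chart `e'`. -/
def jetTransition (k : ℕ) (e e' : OpenPartialHomeomorph E (ℝ × (Fin n → ℝ))) (x : JetCoord n k) :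
    JetCoord n k :=
  (x.1, fun i => iteratedDeriv i (fun s => (e' (e.symm (s, taylorCurve x s))).2) x.1)

lemma IsAdaptedChart.contDiffOn_change (he : IsAdaptedChart n π e) (he' : IsAdaptedChart n π e') :
    ContDiffOn ℝ ∞ (fun z => e' (e.symm z)) (e.target ∩ e.symm ⁻¹' e'.source) := by
  have := he'.contMDiffOn.comp (he.contMDiffOn_symm.mono
    (inter_subset_left (t := e.symm ⁻¹' e'.source))) (fun z hz => hz.2)
  exact this.contDiffOn

lemma sectionCoord_zero (he : IsAdaptedChart n π e) (p : PointedSection n π)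
    (hp : p.1.2 p.1.1 ∈ e.source) :
    ((sectionCoord k e p.1).1, (sectionCoord k e p.1).2 0) = e (p.1.2 p.1.1) := by
  refine Prod.ext ?_ ?_
  · exact (p.2.self_of_nhds.2.symm).trans (he.fst_eq _ hp).symm
  · simp [sectionCoord]

lemma sectionCoord_transition (he : IsAdaptedChart n π e) (he' : IsAdaptedChart n π e')
    (p : PointedSection n π) (hp : p.1.2 p.1.1 ∈ e.source) (hp' : p.1.2 p.1.1 ∈ e'.source) :
    sectionCoord k e' p.1 = jetTransition k e e' (sectionCoord k e p.1) := by
  set t := p.1.1 with ht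
  set φ := p.1.2 with hφ
  set x := sectionCoord k e p.1 with hx
  have hz := sectionCoord_zero (k := k) he p hp
  refine Prod.ext rfl (funext fun i => ?_)
  change iteratedDeriv i (fun s => (e' (φ s)).2) t =
    iteratedDeriv i (fun s => (e' (e.symm (s, taylorCurve x s))).2) t
  let G : ℝ × (Fin n → ℝ) → (Fin n → ℝ) := fun z => (e' (e.symm z)).2
  let a : ℝ → ℝ × (Fin n → ℝ) := fun s => (s, (e (φ s)).2)
  let b : ℝ → ℝ × (Fin n → ℝ) := fun s => (s, taylorCurve x s)
  have hat : a t = e (φ t) := hz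
  have hmem : a t ∈ e.target ∩ e.symm ⁻¹' e'.source := by
    rw [hat]
    exact ⟨e.map_source hp, by rw [mem_preimage, e.left_inv hp]; exact hp'⟩
  have hG : ContDiffAt ℝ ∞ G (a t) :=
    contDiffAt_snd.comp _ ((he.contDiffOn_change he').contDiffAt
      ((e.isOpen_inter_preimage_symm e'.open_source).mem_nhds hmem))
  have hc : ContDiffAt ℝ ∞ (fun s => (e (φ s)).2) t :=
    contDiffAt_snd.comp _ (PointedSection.contDiffAt he p hp)
  have hd : ContDiffAt ℝ ∞ (taylorCurve x) t := (contDiff_taylorCurve' x).contDiffAt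
  have hi : i.1 ≤ k := Nat.lt_succ_iff.1 i.2
  have hcd : ∀ j ≤ k, iteratedDeriv j a t = iteratedDeriv j b t := by
    intro j hj
    have h1 := iteratedDeriv_taylorCurve x (⟨j, Nat.lt_succ_of_le hj⟩ : Fin (k + 1))
    have h2 : iteratedDeriv j a t = _ := iteratedDeriv_prodMk contDiffAt_id hc j
    have h3 : iteratedDeriv j b t = _ := iteratedDeriv_prodMk contDiffAt_id hd j
    rw [h2, h3]
    exact Prod.ext rfl h1.symm
  have ha : ContDiffAt ℝ ∞ a t := contDiffAt_id.prodMk hc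
  have hb : ContDiffAt ℝ ∞ b t := contDiffAt_id.prodMk hd
  have hres := iteratedDeriv_comp_congr hG ha hb hcd i hi
  change _ = iteratedDeriv i (G ∘ b) t
  rw [← hres]
  apply Filter.EventuallyEq.iteratedDeriv_eq
  filter_upwards [p.eventually_mem hp, p.2] with s hs hs'
  have h1 : a s = e (φ s) := Prod.ext ((hs'.2.symm).trans (he.fst_eq _ hs).symm) rfl
  simp only [Function.comp_apply, G, h1]
  rw [e.left_inv hs]

lemma contDiffOn_jetTransition (he : IsAdaptedChart n π e) (he' : IsAdaptedChart n π e') :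
    ContDiffOn ℝ ∞ (jetTransition k e e')
      {x : JetCoord n k | (x.1, x.2 0) ∈ e.target ∩ e.symm ⁻¹' e'.source} := by
  let b : JetCoord n k × ℝ → ℝ × (Fin n → ℝ) := fun p => (p.2, taylorCurve p.1 p.2)
  have hb : ContDiff ℝ ∞ b := contDiff_snd.prodMk contDiff_taylorCurve
  let O : Set (JetCoord n k × ℝ) := b ⁻¹' (e.target ∩ e.symm ⁻¹' e'.source)
  have hO : IsOpen O := (e.isOpen_inter_preimage_symm e'.open_source).preimage hb.continuous
  have hg0 : ContDiffOn ℝ ∞ (fun p => e' (e.symm (b p))) O :=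
    (he.contDiffOn_change he').comp hb.contDiffOn (fun p hp => hp)
  have hg : ContDiffOn ℝ ∞ (fun p => (e' (e.symm (b p))).2) O := hg0.snd
  have h2 : ContDiff ℝ ∞ (fun x : JetCoord n k => (x, x.1)) := contDiff_id.prodMk contDiff_fst
  have h3 : MapsTo (fun x : JetCoord n k => (x, x.1))
      {x : JetCoord n k | (x.1, x.2 0) ∈ e.target ∩ e.symm ⁻¹' e'.source} O := by
    intro x hx
    have hx' : (x.1, x.2 0) ∈ e.target ∩ e.symm ⁻¹' e'.source := hx
    change (x.1, taylorCurve x x.1) ∈ e.target ∩ e.symm ⁻¹' e'.source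
    rwa [taylorCurve_self]
  have h4 : ∀ i : Fin (k + 1), ContDiffOn ℝ ∞
      (fun x : JetCoord n k =>
        iteratedDeriv i (fun s => (e' (e.symm (s, taylorCurve x s))).2) x.1)
      {x : JetCoord n k | (x.1, x.2 0) ∈ e.target ∩ e.symm ⁻¹' e'.source} := by
    intro i
    have h5 := contDiffOn_iteratedDeriv_param hO hg i
    have h6 := h5.comp h2.contDiffOn h3
    exact h6
  exact contDiffOn_fst.prodMk (contDiffOn_pi.2 h4)

/-- The section of `π` whose expression in the chart `e` is the Taylor polynomial with
coefficients `x`. -/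
def taylorSection (he : IsAdaptedChart n π e) (x : JetCoord n k) (hx : (x.1, x.2 0) ∈ e.target) :
    PointedSection n π :=
  ⟨(x.1, fun s => e.symm (s, taylorCurve x s)), by
    have hb : ContDiff ℝ ∞ (fun s : ℝ => (s, taylorCurve x s)) :=
      contDiff_id.prodMk (contDiff_taylorCurve' x)
    have hev : ∀ᶠ s in 𝓝 x.1, (s, taylorCurve x s) ∈ e.target :=
      hb.continuous.continuousAt.eventually (e.open_target.mem_nhds (by simpa using hx))
    filter_upwards [hev] with s hs
    refine ⟨?_, ?_⟩
    · exact (he.contMDiffOn_symm.contMDiffAt (e.open_target.mem_nhds hs)).comp s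
        hb.contDiffAt.contMDiffAt
    · rw [← he.fst_eq _ (e.map_target hs), e.right_inv hs]⟩

lemma taylorSection_point (he : IsAdaptedChart n π e) (x : JetCoord n k)
    (hx : (x.1, x.2 0) ∈ e.target) :
    (taylorSection he x hx).1.2 (taylorSection he x hx).1.1 = e.symm (x.1, x.2 0) := by
  simp [taylorSection]

lemma sectionCoord_taylorSection (he : IsAdaptedChart n π e) (x : JetCoord n k)
    (hx : (x.1, x.2 0) ∈ e.target) : sectionCoord k e (taylorSection he x hx).1 = x := by
  refine Prod.ext rfl (funext fun i => ?_)
  rw [← iteratedDeriv_taylorCurve x i]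
  apply Filter.EventuallyEq.iteratedDeriv_eq
  have hb : Continuous (fun s : ℝ => (s, taylorCurve x s)) :=
    continuous_id.prodMk (contDiff_taylorCurve' x).continuous
  have hx' : (x.1, taylorCurve x x.1) ∈ e.target := by rwa [taylorCurve_self]
  filter_upwards [hb.continuousAt.eventually (e.open_target.mem_nhds hx')] with s hs
  simp [taylorSection, e.right_inv hs]

namespace Jet

lemma point_mk (p : PointedSection n π) :
    Jet.point (Quotient.mk (jetSetoid n π k) p) = p.1.2 p.1.1 := rfl

lemma point_out (j : Jet n π k) : j.out.1.2 j.out.1.1 = j.point := by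
  conv_rhs => rw [← Quotient.out_eq j]
  rfl

lemma coord_mk (he : IsAdaptedChart n π e) (p : PointedSection n π)
    (hp : p.1.2 p.1.1 ∈ e.source) :
    Jet.coord e (Quotient.mk (jetSetoid n π k) p) = sectionCoord k e p.1 := by
  have h := Quotient.exact (Quotient.out_eq (Quotient.mk (jetSetoid n π k) p))
  exact h.2.2 e he (h.2.1 ▸ hp)

lemma coord_transition (he : IsAdaptedChart n π e) (he' : IsAdaptedChart n π e') (j : Jet n π k)
    (hj : j.point ∈ e.source) (hj' : j.point ∈ e'.source) :
    coord e' j = jetTransition k e e' (coord e j) :=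
  sectionCoord_transition he he' _ (by rwa [point_out]) (by rwa [point_out])

lemma coord_zero (he : IsAdaptedChart n π e) (j : Jet n π k) (hj : j.point ∈ e.source) :
    ((coord e j).1, (coord e j).2 0) = e j.point := by
  have := sectionCoord_zero (k := k) he j.out (by rwa [point_out])
  rwa [point_out] at this

lemma bijOn_coord (he : IsAdaptedChart n π e) :
    BijOn (coord e : Jet n π k → JetCoord n k) {j | j.point ∈ e.source}
      {x | (x.1, x.2 0) ∈ e.target} := by
  refine ⟨fun j hj => ?_, fun j hj j' hj' h => ?_, fun x hx => ?_⟩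
  · change ((coord e j).1, (coord e j).2 0) ∈ e.target
    rw [coord_zero he j hj]
    exact e.map_source hj
  · rw [← Quotient.out_eq j, ← Quotient.out_eq j']
    have hpt : j.point = j'.point := by
      apply e.injOn hj hj'
      rw [← coord_zero he j hj, ← coord_zero he j' hj', h]
    refine Quotient.sound (s := jetSetoid n π k)
      ⟨congrArg (fun c : JetCoord n k => c.1) h, ?_, fun e' he' hs => ?_⟩
    · rw [point_out, point_out, hpt]
    · rw [point_out] at hs
      change coord e' j = coord e' j'
      rw [coord_transition he he' j hj hs, coord_transition he he' j' hj' (hpt ▸ hs), h]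
  · have hp : (taylorSection he x hx).1.2 (taylorSection he x hx).1.1 ∈ e.source := by
      rw [taylorSection_point]
      exact e.map_target hx
    refine ⟨Quotient.mk (jetSetoid n π k) (taylorSection he x hx), hp, ?_⟩
    rw [coord_mk he _ hp, sectionCoord_taylorSection]

end Jet

variable [hπ : IsFibredOverLine n π]

instance : Nonempty (Jet n π k) := by
  obtain ⟨x, -⟩ := hπ.surjective 0
  obtain ⟨e, he, hx⟩ := exists_isAdaptedChart (n := n) π x
  let c : JetCoord n k := ((e x).1, fun _ => (e x).2)
  exact ⟨Quotient.mk _ (taylorSection he c (e.map_source hx))⟩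

/-- The chart `(t, q_0^A, …, q_k^A)` of `J^k π` induced by an adapted chart `(t, q^A)` of `E`. -/
def jetChart (k : ℕ) (he : IsAdaptedChart n π e) : PartialEquiv (Jet n π k) (JetCoord n k) :=
  BijOn.toPartialEquiv (Jet.coord e) _ _ (Jet.bijOn_coord he)

lemma jetChart_symm_apply_point (he : IsAdaptedChart n π e) {x : JetCoord n k}
    (hx : (x.1, x.2 0) ∈ e.target) : ((jetChart k he).symm x).point = e.symm (x.1, x.2 0) := by
  have h1 : (jetChart k he).symm x ∈ (jetChart k he).source := (jetChart k he).map_target hx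
  have h2 : Jet.coord e ((jetChart k he).symm x) = x := (jetChart k he).right_inv hx
  have h3 := Jet.coord_zero he _ h1
  rw [h2] at h3
  rw [h3, e.left_inv h1]

lemma jetChart_trans_source (he : IsAdaptedChart n π e) (he' : IsAdaptedChart n π e') :
    ((jetChart k he).symm.trans (jetChart k he')).source =
      {x : JetCoord n k | (x.1, x.2 0) ∈ e.target ∩ e.symm ⁻¹' e'.source} := by
  ext x
  rw [PartialEquiv.trans_source]
  constructor
  · rintro ⟨h1, h2⟩
    have h2' : ((jetChart k he).symm x).point ∈ e'.source := h2
    rw [jetChart_symm_apply_point he h1] at h2'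
    exact ⟨h1, h2'⟩
  · rintro ⟨h1, h2⟩
    refine ⟨h1, ?_⟩
    change ((jetChart k he).symm x).point ∈ e'.source
    rw [jetChart_symm_apply_point he h1]
    exact h2

lemma jetChart_trans_eqOn (he : IsAdaptedChart n π e) (he' : IsAdaptedChart n π e') :
    EqOn ((jetChart k he).symm.trans (jetChart k he')) (jetTransition k e e')
      ((jetChart k he).symm.trans (jetChart k he')).source := by
  intro x hx
  rw [PartialEquiv.trans_source] at hx
  have h1 : Jet.coord e ((jetChart k he).symm x) = x := (jetChart k he).right_inv hx.1
  change Jet.coord e' ((jetChart k he).symm x) = _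
  rw [Jet.coord_transition he he' _ ((jetChart k he).map_target hx.1) hx.2, h1]

lemma isOpen_jetChart_trans_source (he : IsAdaptedChart n π e) (he' : IsAdaptedChart n π e') :
    IsOpen ((jetChart k he).symm.trans (jetChart k he')).source := by
  rw [jetChart_trans_source]
  exact (e.isOpen_inter_preimage_symm e'.open_source).preimage
    (continuous_fst.prodMk ((continuous_apply 0).comp continuous_snd))

lemma contDiffOn_jetChart_trans (he : IsAdaptedChart n π e) (he' : IsAdaptedChart n π e') :
    ContDiffOn ℝ ∞ ((jetChart k he).symm.trans (jetChart k he'))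
      ((jetChart k he).symm.trans (jetChart k he')).source := by
  refine ContDiffOn.congr ?_ (jetChart_trans_eqOn he he')
  rw [jetChart_trans_source]
  exact contDiffOn_jetTransition he he'

/-- A chosen adapted chart of `E` around `x`. -/
def adaptedChartAt (π : E → ℝ) [IsFibredOverLine n π] (x : E) :
    OpenPartialHomeomorph E (ℝ × (Fin n → ℝ)) :=
  (exists_isAdaptedChart (n := n) π x).choose

lemma isAdaptedChart_adaptedChartAt (π : E → ℝ) [IsFibredOverLine n π] (x : E) :
    IsAdaptedChart n π (adaptedChartAt (n := n) π x) :=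
  (exists_isAdaptedChart (n := n) π x).choose_spec.1

lemma mem_adaptedChartAt_source (π : E → ℝ) [IsFibredOverLine n π] (x : E) :
    x ∈ (adaptedChartAt (n := n) π x).source :=
  (exists_isAdaptedChart (n := n) π x).choose_spec.2

variable (n π k) in
/-- The atlas of `J^k π`: all the charts induced by adapted charts of `E`. -/
def jetChartedSpaceCore : ChartedSpaceCore (JetCoord n k) (Jet n π k) where
  atlas := {c | ∃ e, ∃ he : IsAdaptedChart n π e, c = jetChart k he}
  chartAt j := jetChart k (isAdaptedChart_adaptedChartAt π j.point)
  mem_chart_source j := mem_adaptedChartAt_source π j.point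
  chart_mem_atlas _ := ⟨_, _, rfl⟩
  open_source := by
    rintro _ _ ⟨e, he, rfl⟩ ⟨e', he', rfl⟩
    exact isOpen_jetChart_trans_source he he'
  continuousOn_toFun := by
    rintro _ _ ⟨e, he, rfl⟩ ⟨e', he', rfl⟩
    exact (contDiffOn_jetChart_trans he he').continuousOn

instance : TopologicalSpace (Jet n π k) := (jetChartedSpaceCore n π k).toTopologicalSpace

instance : ChartedSpace (JetCoord n k) (Jet n π k) := (jetChartedSpaceCore n π k).toChartedSpace

lemma Jet.exists_of_mem_atlas {c : OpenPartialHomeomorph (Jet n π k) (JetCoord n k)}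
    (hc : c ∈ atlas (JetCoord n k) (Jet n π k)) :
    ∃ e, ∃ he : IsAdaptedChart n π e, c.toPartialEquiv = jetChart k he := by
  have hc' : c ∈ ⋃ (e : PartialEquiv (Jet n π k) (JetCoord n k))
      (he : e ∈ (jetChartedSpaceCore n π k).atlas),
      {(jetChartedSpaceCore n π k).openPartialHomeomorph e he} := hc
  simp only [mem_iUnion, mem_singleton_iff] at hc'
  obtain ⟨_, ⟨e, he, rfl⟩, rfl⟩ := hc'
  exact ⟨e, he, rfl⟩

lemma Jet.chartAt_toPartialEquiv (j : Jet n π k) :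
    (chartAt (JetCoord n k) j).toPartialEquiv =
      jetChart k (isAdaptedChart_adaptedChartAt π j.point) := rfl

lemma Jet.contDiffOn_atlas {c c' : OpenPartialHomeomorph (Jet n π k) (JetCoord n k)}
    (hc : c ∈ atlas (JetCoord n k) (Jet n π k)) (hc' : c' ∈ atlas (JetCoord n k) (Jet n π k)) :
    ContDiffOn ℝ ∞ (c' ∘ c.symm) (c.symm ≫ₕ c').source := by
  obtain ⟨e, he, h⟩ := Jet.exists_of_mem_atlas hc
  obtain ⟨e', he', h'⟩ := Jet.exists_of_mem_atlas hc'
  have := contDiffOn_jetChart_trans (k := k) he he'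
  rw [← h, ← h'] at this
  exact this

instance : IsManifold 𝓘(ℝ, JetCoord n k) ∞ (Jet n π k) :=
  isManifold_of_contDiffOn _ _ _ fun c c' hc hc' => by
    simpa using Jet.contDiffOn_atlas hc hc'

end Jets

/-! ### Cotangent bundle of the jets and its restricted quotient -/

section Momenta

variable (n : ℕ) {E : Type*} [TopologicalSpace E]
  [ChartedSpace (EuclideanSpace ℝ (Fin (n + 1))) E] (π : E → ℝ) [IsFibredOverLine n π] (k : ℕ)

/-- The cotangent bundle `T*(J^k π)`. -/
abbrev CotangentJet : Type _ :=
  Bundle.TotalSpace (JetCoord n k →L[ℝ] ℝ)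
    (fun x : Jet n π k => TangentSpace 𝓘(ℝ, JetCoord n k) x →L[ℝ] Bundle.Trivial (Jet n π k) ℝ x)

/-- The model of `T*(J^k π)`. -/
abbrev cotangentModel := (𝓘(ℝ, JetCoord n k)).prod 𝓘(ℝ, JetCoord n k →L[ℝ] ℝ)

variable {n π k}

lemma Jet.chart_change_fst {c c' : OpenPartialHomeomorph (Jet n π k) (JetCoord n k)}
    (hc : c ∈ atlas (JetCoord n k) (Jet n π k)) (hc' : c' ∈ atlas (JetCoord n k) (Jet n π k))
    {z : JetCoord n k} (hz : z ∈ (c.symm ≫ₕ c').source) : (c' (c.symm z)).1 = z.1 := by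
  obtain ⟨e, he, h⟩ := Jet.exists_of_mem_atlas hc
  obtain ⟨e', he', h'⟩ := Jet.exists_of_mem_atlas hc'
  have h1 := jetChart_trans_eqOn (k := k) he he'
  rw [← h, ← h'] at h1
  have h2 := h1 hz
  change c' (c.symm z) = _ at h2
  rw [h2]
  rfl

/-- Changes of the induced jet coordinates map vertical vectors to vertical vectors. -/
lemma Jet.coordChange_vertical (i j : atlas (JetCoord n k) (Jet n π k)) {x : Jet n π k}
    (hi : x ∈ i.1.source) (hj : x ∈ j.1.source) (w : Fin (k + 1) → Fin n → ℝ) :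
    ((tangentBundleCore 𝓘(ℝ, JetCoord n k) (Jet n π k)).coordChange i j x (0, w)).1 = 0 := by
  have hz : i.1 x ∈ (i.1.symm ≫ₕ j.1).source := by
    rw [OpenPartialHomeomorph.trans_source]
    exact ⟨i.1.map_source hi, by simpa [i.1.left_inv hi] using hj⟩
  have ho : (i.1.symm ≫ₕ j.1).source ∈ 𝓝 (i.1 x) := (i.1.symm ≫ₕ j.1).open_source.mem_nhds hz
  have hd : DifferentiableAt ℝ (j.1 ∘ i.1.symm) (i.1 x) :=
    ((Jet.contDiffOn_atlas i.2 j.2).contDiffAt ho).differentiableAt (by simp)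
  have h1 : HasFDerivAt (fun z => (j.1 (i.1.symm z)).1)
      ((ContinuousLinearMap.fst ℝ ℝ (Fin (k + 1) → Fin n → ℝ)).comp
        (fderiv ℝ (j.1 ∘ i.1.symm) (i.1 x))) (i.1 x) :=
    (ContinuousLinearMap.fst ℝ ℝ (Fin (k + 1) → Fin n → ℝ)).hasFDerivAt.comp (i.1 x)
      hd.hasFDerivAt
  have h2 : HasFDerivAt (fun z => (j.1 (i.1.symm z)).1)
      (ContinuousLinearMap.fst ℝ ℝ (Fin (k + 1) → Fin n → ℝ)) (i.1 x) := by
    refine (ContinuousLinearMap.fst ℝ ℝ (Fin (k + 1) → Fin n → ℝ)).hasFDerivAt.congr_of_eventuallyEq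
      ?_
    filter_upwards [ho] with z hz
    exact Jet.chart_change_fst i.2 j.2 hz
  have h3 := congrArg (fun L => L ((0 : ℝ), w)) (h1.unique h2)
  have h4 : (tangentBundleCore 𝓘(ℝ, JetCoord n k) (Jet n π k)).coordChange i j x =
      fderiv ℝ (j.1 ∘ i.1.symm) (i.1 x) := by
    simp [tangentBundleCore_coordChange, fderivWithin_univ]
  rw [h4]
  exact h3

variable (n π k) in
/-- The action of a change of induced jet coordinates on vertical tangent vectors. -/
def verticalChange (i j : atlas (JetCoord n k) (Jet n π k)) (x : Jet n π k) :
    (Fin (k + 1) → Fin n → ℝ) →L[ℝ] (Fin (k + 1) → Fin n → ℝ) :=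
  (ContinuousLinearMap.snd ℝ ℝ (Fin (k + 1) → Fin n → ℝ)).comp
    (((tangentBundleCore 𝓘(ℝ, JetCoord n k) (Jet n π k)).coordChange i j x).comp
      (ContinuousLinearMap.inr ℝ ℝ (Fin (k + 1) → Fin n → ℝ)))

lemma verticalChange_spec (i j : atlas (JetCoord n k) (Jet n π k)) {x : Jet n π k}
    (hi : x ∈ i.1.source) (hj : x ∈ j.1.source) (w : Fin (k + 1) → Fin n → ℝ) :
    (tangentBundleCore 𝓘(ℝ, JetCoord n k) (Jet n π k)).coordChange i j x (0, w) =
      (0, verticalChange n π k i j x w) :=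
  Prod.ext (Jet.coordChange_vertical i j hi hj w) rfl

lemma contMDiffOn_verticalChange (i j : atlas (JetCoord n k) (Jet n π k)) :
    ContMDiffOn 𝓘(ℝ, JetCoord n k)
      𝓘(ℝ, (Fin (k + 1) → Fin n → ℝ) →L[ℝ] (Fin (k + 1) → Fin n → ℝ)) ∞
      (verticalChange n π k i j) (i.1.source ∩ j.1.source) := by
  have : IsManifold 𝓘(ℝ, JetCoord n k) (∞ + 1) (Jet n π k) :=
    inferInstanceAs (IsManifold 𝓘(ℝ, JetCoord n k) ∞ (Jet n π k))
  have : (tangentBundleCore 𝓘(ℝ, JetCoord n k) (Jet n π k)).IsContMDiff 𝓘(ℝ, JetCoord n k) ∞ :=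
    tangentBundleCore.isContMDiff
  have h := (tangentBundleCore 𝓘(ℝ, JetCoord n k) (Jet n π k)).contMDiffOn_coordChange
    𝓘(ℝ, JetCoord n k) (n := ∞) i j
  exact contMDiffOn_const.clm_comp (h.clm_comp contMDiffOn_const)

variable (n π k) in
/-- The vector bundle `J^k π^* = T*(J^k π) / (π̄^k)^* T*ℝ` over `J^k π`. A covector modulo the
multiples of `dt` is the same thing as its restriction to the vertical vectors (those of the form
`(0, w)` in induced coordinates), so that in the induced coordinates the fibre is the dual of
the space of the vectors `w`, and these restrictions are transported by vertical changes. -/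
def restrictedCore : VectorBundleCore ℝ (Jet n π k) ((Fin (k + 1) → Fin n → ℝ) →L[ℝ] ℝ)
    (atlas (JetCoord n k) (Jet n π k)) where
  baseSet i := i.1.source
  isOpen_baseSet i := i.1.open_source
  indexAt := achart (JetCoord n k)
  mem_baseSet_at := mem_chart_source (JetCoord n k)
  coordChange i j x := (ContinuousLinearMap.compL ℝ (Fin (k + 1) → Fin n → ℝ)
    (Fin (k + 1) → Fin n → ℝ) ℝ).flip (verticalChange n π k j i x)
  coordChange_self i x hx p := by
    ext1 w
    have h1 := verticalChange_spec i i hx hx w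
    rw [(tangentBundleCore 𝓘(ℝ, JetCoord n k) (Jet n π k)).coordChange_self i x hx] at h1
    have h2 : verticalChange n π k i i x w = w := (congrArg Prod.snd h1).symm
    simp [h2]
  continuousOn_coordChange i j := by
    have h := (contMDiffOn_verticalChange (n := n) (π := π) (k := k) j i).continuousOn
    rw [inter_comm]
    exact (ContinuousLinearMap.continuous _).comp_continuousOn h
  coordChange_comp i j l x hx p := by
    ext1 w
    have h1 := verticalChange_spec l i hx.2 hx.1.1 w
    rw [← (tangentBundleCore 𝓘(ℝ, JetCoord n k) (Jet n π k)).coordChange_comp l j i x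
      ⟨⟨hx.2, hx.1.2⟩, hx.1.1⟩, verticalChange_spec l j hx.2 hx.1.2,
      verticalChange_spec j i hx.1.2 hx.1.1] at h1
    have h2 : verticalChange n π k j i x (verticalChange n π k l j x w) =
      verticalChange n π k l i x w := (Prod.mk.inj h1).2
    simp [h2]

instance : (restrictedCore n π k).IsContMDiff 𝓘(ℝ, JetCoord n k) ∞ where
  contMDiffOn_coordChange i j := by
    have h := contMDiffOn_verticalChange (n := n) (π := π) (k := k) j i
    rw [inter_comm] at h
    exact (ContinuousLinearMap.contMDiff _).comp_contMDiffOn h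

variable (n π k)

/-- The manifold `J^k π^*`. -/
abbrev RestrictedJet : Type _ :=
  Bundle.TotalSpace ((Fin (k + 1) → Fin n → ℝ) →L[ℝ] ℝ) (restrictedCore n π k).Fiber

/-- The model of `J^k π^*`. -/
abbrev restrictedModel := (𝓘(ℝ, JetCoord n k)).prod 𝓘(ℝ, (Fin (k + 1) → Fin n → ℝ) →L[ℝ] ℝ)

variable {n π k}

/-- The quotient map `μ : T*(J^k π) → J^k π^*`. -/
def quotientMap (α : CotangentJet n π k) : RestrictedJet n π k :=
  ⟨α.1, ContinuousLinearMap.comp (α.2 : JetCoord n k →L[ℝ] ℝ)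
    (ContinuousLinearMap.inr ℝ ℝ (Fin (k + 1) → Fin n → ℝ))⟩

lemma Jet.continuous_time : Continuous (Jet.time : Jet n π k → ℝ) := by
  rw [continuous_iff_continuousAt]
  intro x
  have h : ContinuousAt (fun y : Jet n π k => (chartAt (JetCoord n k) x y).1) x :=
    continuousAt_fst.comp ((chartAt (JetCoord n k) x).continuousAt (mem_chart_source _ x))
  refine h.congr (Eventually.of_forall fun y => ?_)
  conv_rhs => rw [← Quotient.out_eq y]
  rfl

/-- The `1`-form `(π̄^k)^* η` on `J^k π`, where `η = dt`. -/
def Jet.dt (x : Jet n π k) : TangentSpace 𝓘(ℝ, JetCoord n k) x →L[ℝ] ℝ :=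
  mfderiv 𝓘(ℝ, JetCoord n k) 𝓘(ℝ, ℝ) (Jet.time : Jet n π k → ℝ) x

lemma Jet.dt_eq (x : Jet n π k) :
    Jet.dt x = ContinuousLinearMap.fst ℝ ℝ (Fin (k + 1) → Fin n → ℝ) := by
  have h : HasMFDerivAt 𝓘(ℝ, JetCoord n k) 𝓘(ℝ, ℝ) (Jet.time : Jet n π k → ℝ) x
      (ContinuousLinearMap.fst ℝ ℝ (Fin (k + 1) → Fin n → ℝ)) := by
    refine ⟨Jet.continuous_time.continuousAt, ?_⟩
    refine HasFDerivAt.hasFDerivWithinAt ?_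
    refine (ContinuousLinearMap.fst ℝ ℝ (Fin (k + 1) → Fin n → ℝ)).hasFDerivAt.congr_of_eventuallyEq
      ?_
    filter_upwards [extChartAt_target_mem_nhds (I := 𝓘(ℝ, JetCoord n k)) x] with z hz
    have h1 : extChartAt 𝓘(ℝ, JetCoord n k) x ((extChartAt 𝓘(ℝ, JetCoord n k) x).symm z) = z :=
      (extChartAt 𝓘(ℝ, JetCoord n k) x).right_inv hz
    have h2 : ∀ y : Jet n π k, Jet.time y = (extChartAt 𝓘(ℝ, JetCoord n k) x y).1 := by
      intro y
      conv_lhs => rw [← Quotient.out_eq y]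
      rfl
    simp only [writtenInExtChartAt, Function.comp_apply, h2, h1]
    rfl
  exact h.mfderiv

lemma quotientMap_surjective :
    Function.Surjective (quotientMap : CotangentJet n π k → RestrictedJet n π k) := by
  rintro ⟨x, p⟩
  refine ⟨⟨x, ContinuousLinearMap.comp (p : (Fin (k + 1) → Fin n → ℝ) →L[ℝ] ℝ)
    (ContinuousLinearMap.snd ℝ ℝ (Fin (k + 1) → Fin n → ℝ))⟩, ?_⟩
  have h : (ContinuousLinearMap.comp (p : (Fin (k + 1) → Fin n → ℝ) →L[ℝ] ℝ)
    (ContinuousLinearMap.snd ℝ ℝ (Fin (k + 1) → Fin n → ℝ))).comp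
      (ContinuousLinearMap.inr ℝ ℝ (Fin (k + 1) → Fin n → ℝ)) = p := by
    rfl
  exact congrArg (fun q : (Fin (k + 1) → Fin n → ℝ) →L[ℝ] ℝ =>
    (⟨x, q⟩ : RestrictedJet n π k)) h

lemma comp_inr_eq_iff (α β : JetCoord n k →L[ℝ] ℝ) :
    α.comp (ContinuousLinearMap.inr ℝ ℝ (Fin (k + 1) → Fin n → ℝ)) =
      β.comp (ContinuousLinearMap.inr ℝ ℝ (Fin (k + 1) → Fin n → ℝ)) ↔
      ∃ c : ℝ, α = β + c • ContinuousLinearMap.fst ℝ ℝ (Fin (k + 1) → Fin n → ℝ) := by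
  constructor
  · intro h1
    refine ⟨α (1, 0) - β (1, 0), ?_⟩
    refine ContinuousLinearMap.ext fun v => ?_
    obtain ⟨τ, w⟩ := v
    have h3 := congrArg (fun L => L w) h1
    simp only [ContinuousLinearMap.comp_apply, ContinuousLinearMap.inr_apply] at h3
    have h4 : ((τ, w) : JetCoord n k) = τ • ((1, 0) : JetCoord n k) + (0, w) := by
      ext <;> simp
    rw [h4]
    simp only [map_add, map_smul, add_apply, smul_apply,
      ContinuousLinearMap.coe_fst', h3, smul_eq_mul]
    simp
  · rintro ⟨c, rfl⟩
    ext1 w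
    simp

/-- `μ` identifies two covectors at a point exactly when they differ by a multiple of `dt`. -/
lemma quotientMap_eq_iff (x : Jet n π k) (α β : TangentSpace 𝓘(ℝ, JetCoord n k) x →L[ℝ] ℝ) :
    quotientMap (⟨x, α⟩ : CotangentJet n π k) = quotientMap ⟨x, β⟩ ↔
      ∃ c : ℝ, α = β + c • Jet.dt x := by
  rw [Jet.dt_eq]
  refine Iff.trans ?_ (comp_inr_eq_iff (n := n) (k := k) α β)
  constructor
  · intro h
    exact eq_of_heq ((Bundle.TotalSpace.mk.injEq x _ x _).mp h).2
  · intro h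
    exact congrArg (fun q : (Fin (k + 1) → Fin n → ℝ) →L[ℝ] ℝ =>
      (⟨x, q⟩ : RestrictedJet n π k)) h

end Momenta

/-! ### Tangent spaces of submanifolds, vector fields and forms -/

section Forms

variable {V : Type*} [NormedAddCommGroup V] [NormedSpace ℝ V] {H : Type*} [TopologicalSpace H]
  {I : ModelWithCorners ℝ V H} {M : Type*} [TopologicalSpace M] [ChartedSpace H M]
  {V' : Type*} [NormedAddCommGroup V'] [NormedSpace ℝ V'] {H' : Type*} [TopologicalSpace H']
  {I' : ModelWithCorners ℝ V' H'} {M' : Type*} [TopologicalSpace M'] [ChartedSpace H' M']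

variable (I) in
/-- The tangent space `T_w S` of a submanifold `S` of `M` at `w`: the velocities at `w` of the
smooth curves contained in `S`. -/
def tangentSet (S : Set M) (w : M) : Set (TangentSpace I w) :=
  {v | ∃ γ : ℝ → M, (∀ᶠ s in 𝓝 0, ContMDiffAt 𝓘(ℝ, ℝ) I ∞ γ s ∧ γ s ∈ S) ∧
    (⟨γ 0, mfderiv 𝓘(ℝ, ℝ) I γ 0 (1 : ℝ)⟩ : TangentBundle I M) = ⟨w, v⟩}

variable (I) in
/-- `X` is a smooth vector field along the subset `S` of `M`. -/
def IsSmoothAlong [IsManifold I 1 M] (S : Set M) (X : ∀ w : S, TangentSpace I (w : M)) : Prop :=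
  ∃ Y : ∀ w : M, TangentSpace I w,
    ContMDiffOn I I.tangent ∞ (fun w => (⟨w, Y w⟩ : TangentBundle I M)) S ∧
      ∀ w : S, Y w = X w

/-- The exterior derivative of a `1`-form `θ` on a manifold without boundary, computed in the chart
around `x`: `dθ(u, v) = u(θ(v)) - v(θ(u))` for constant `u`, `v`. -/
def extDerivOne (θ : ∀ x : M, TangentSpace I x →L[ℝ] ℝ) (x : M) (u v : TangentSpace I x) : ℝ :=
  let θ' : V → (V →L[ℝ] ℝ) := fun z =>
    (θ ((extChartAt I x).symm z)).comp (mfderiv 𝓘(ℝ, V) I (extChartAt I x).symm z)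
  fderiv ℝ θ' (extChartAt I x x) u v - fderiv ℝ θ' (extChartAt I x x) v u

/-- The pull-back `f^* Ψ` of a `2`-form. -/
def pullbackTwo (f : M → M') (Ψ : ∀ x : M', TangentSpace I' x → TangentSpace I' x → ℝ) (x : M)
    (u v : TangentSpace I x) : ℝ :=
  Ψ (f x) (mfderiv I I' f x u) (mfderiv I I' f x v)

end Forms

section Canonical

variable {n : ℕ} {E : Type*} [TopologicalSpace E]
  [ChartedSpace (EuclideanSpace ℝ (Fin (n + 1))) E] {π : E → ℝ} [IsFibredOverLine n π] {k : ℕ}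

/-- The tautological `1`-form `Θ` of `T*(J^k π)`. -/
def tautologicalForm (α : CotangentJet n π k) : TangentSpace (cotangentModel n k) α →L[ℝ] ℝ :=
  ContinuousLinearMap.comp α.2
    (mfderiv (cotangentModel n k) 𝓘(ℝ, JetCoord n k) Bundle.TotalSpace.proj α)

/-- The canonical symplectic form `Ω = -dΘ` of `T*(J^k π)`. -/
def canonicalForm (α : CotangentJet n π k) (u v : TangentSpace (cotangentModel n k) α) : ℝ :=
  -extDerivOne tautologicalForm α u v

variable (n π k) in
/-- The prolongation `j^k φ` of `φ` (with an arbitrary value where `φ` is not a section). -/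
def prolongation (φ : ℝ → E) (s : ℝ) : Jet n π k :=
  open Classical in
  if h : IsLocalSection n π φ s then Quotient.mk (jetSetoid n π k) ⟨(s, φ), h⟩
  else Classical.arbitrary _

end Canonical

/-! ### The Legendre–Ostrogradsky maps -/

section Legendre

variable {n k : ℕ}

/-- `∂/∂q_m^A` in the induced coordinates of the `k`-jets. -/
def partialQ (k m : ℕ) (A : Fin n) : JetCoord n k :=
  (0, fun i => if (i : ℕ) = m then Pi.single A 1 else 0)

/-- The total time derivative `d_T = ∂/∂t + q_{i+1}^A ∂/∂q_i^A` in the coordinates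
`(t, q_0^A, …, q_N^A)`, on functions which do not depend on `q_N^A`. -/
def totalDeriv (N : ℕ) (f : JetCoord n N → ℝ) (x : JetCoord n N) : ℝ :=
  fderiv ℝ f x (1, fun i => if h : (i : ℕ) + 1 < N + 1 then x.2 ⟨i + 1, h⟩ else 0)

/-- The expression of `π^N_k` in induced coordinates. -/
def truncate {N : ℕ} (h : k ≤ N) (x : JetCoord n N) : JetCoord n k :=
  (x.1, fun i => x.2 (Fin.castLE (by omega) i))

/-- The Jacobi–Ostrogradsky momenta
`p_A^r = ∑_{i = 0}^{k - 1 - r} (-1)^i d_T^i (∂ℓ/∂q_{r + 1 + i}^A)`, for `0 ≤ r ≤ k - 1`, of the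
coordinate expression `ℓ` of a `k`-th order Lagrangian function. -/
def momentum (hk : 1 ≤ k) (ℓ : JetCoord n k → ℝ) (x : JetCoord n (2 * k - 1))
    (r : Fin (k - 1 + 1)) (A : Fin n) : ℝ :=
  ∑ i ∈ Finset.range (k - r), (-1) ^ i *
    (totalDeriv (2 * k - 1))^[i]
      (fun y => fderiv ℝ ℓ (truncate (by omega) y) (partialQ k (r + 1 + i) A)) x

/-- `dq_r^A` in the induced coordinates of the `k`-jets. -/
def dq (r : Fin (k + 1)) (A : Fin n) : JetCoord n k →L[ℝ] ℝ :=
  (ContinuousLinearMap.proj (R := ℝ) (φ := fun _ : Fin n => ℝ) A).comp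
    ((ContinuousLinearMap.proj (R := ℝ) (φ := fun _ : Fin (k + 1) => Fin n → ℝ) r).comp
      (ContinuousLinearMap.snd ℝ ℝ (Fin (k + 1) → Fin n → ℝ)))

/-- The covector `p dt + p_A^r dq_r^A`, where `p = L - p_A^r q_{r+1}^A`. -/
def legendreCovector (hk : 1 ≤ k) (ℓ : JetCoord n k → ℝ) (x : JetCoord n (2 * k - 1)) :
    JetCoord n (k - 1) →L[ℝ] ℝ :=
  (ℓ (truncate (by omega) x) -
      ∑ r : Fin (k - 1 + 1), ∑ A, momentum hk ℓ x r A * x.2 ⟨r + 1, by omega⟩ A) •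
    ContinuousLinearMap.fst ℝ ℝ (Fin (k - 1 + 1) → Fin n → ℝ) +
  ∑ r : Fin (k - 1 + 1), ∑ A, momentum hk ℓ x r A • dq r A

variable {E : Type*} [TopologicalSpace E]
  [ChartedSpace (EuclideanSpace ℝ (Fin (n + 1))) E] {π : E → ℝ} [IsFibredOverLine n π]

/-- The extended Legendre–Ostrogradsky map `J^{2k-1} π → T*(J^{k-1} π)`, given in induced
coordinates by `p_A^r = ∑ (-1)^i d_T^i (∂L/∂q_{r+1+i}^A)` and `p = L - p_A^r q_{r+1}^A`. These
formulas do not depend on the adapted chart; at each point the chart used is the one through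
which the tangent space of `J^{k-1} π` is identified with the coordinate space. -/
def extendedLegendre (hk : 1 ≤ k) (L : Jet n π k → ℝ) (y : Jet n π (2 * k - 1)) :
    CotangentJet n π (k - 1) :=
  let x : Jet n π (k - 1) := y.proj (by omega)
  ⟨x, legendreCovector hk
    (fun z => L ((jetChart k (isAdaptedChart_adaptedChartAt π x.point)).symm z))
    (y.coord (adaptedChartAt π x.point))⟩

/-- The restricted Legendre–Ostrogradsky map `J^{2k-1} π → J^{k-1} π^*`. -/
def restrictedLegendre (hk : 1 ≤ k) (L : Jet n π k → ℝ) (y : Jet n π (2 * k - 1)) :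
    RestrictedJet n π (k - 1) :=
  quotientMap (extendedLegendre hk L y)

/-- The Lagrangian (density `L dt`) is hyperregular: the restricted Legendre–Ostrogradsky map is a
global diffeomorphism. -/
def IsHyperregular (hk : 1 ≤ k) (L : Jet n π k → ℝ) : Prop :=
  ∃ Φ : Diffeomorph 𝓘(ℝ, JetCoord n (2 * k - 1)) (restrictedModel n (k - 1))
    (Jet n π (2 * k - 1)) (RestrictedJet n π (k - 1)) ∞, ⇑Φ = restrictedLegendre hk L

end Legendre

/-! ### The unified formalism -/

section Unified

variable {n : ℕ} {E : Type*} [TopologicalSpace E]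
  [ChartedSpace (EuclideanSpace ℝ (Fin (n + 1))) E] {π : E → ℝ} [IsFibredOverLine n π] {k : ℕ}

variable (n π k) in
/-- The product `J^{2k-1} π × T*(J^{k-1} π)`, in which `W`, `W_o` and `W_1` are submanifolds. -/
abbrev JetMomentum : Type _ := Jet n π (2 * k - 1) × CotangentJet n π (k - 1)

variable (n k) in
/-- The model of `J^{2k-1} π × T*(J^{k-1} π)`. -/
abbrev jetMomentumModel := (𝓘(ℝ, JetCoord n (2 * k - 1))).prod (cotangentModel n (k - 1))

variable (n π k) in
/-- The extended jet-momentum bundle `W = J^{2k-1} π ×_{J^{k-1} π} T*(J^{k-1} π)`. -/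
def extendedBundle : Set (JetMomentum n π k) :=
  {w | w.1.proj (by omega : k - 1 ≤ 2 * k - 1) = w.2.proj}

/-- The coupling function `Ĉ`, where `Ĉ dt` is the coupling `1`-form on `W`: its value at `(ȳ, α)`
is `α ((j^{k-1} φ)_* ∂/∂t)` for a representative `φ` of the jet `ȳ`. -/
def coupling (w : JetMomentum n π k) : ℝ :=
  (w.2.2 : TangentSpace 𝓘(ℝ, JetCoord n (k - 1)) w.2.1 →L[ℝ] ℝ)
    (mfderiv 𝓘(ℝ, ℝ) 𝓘(ℝ, JetCoord n (k - 1)) (prolongation n π (k - 1) w.1.out.1.2) w.1.time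
      (1 : ℝ))

/-- The Hamiltonian submanifold `W_o = {w ∈ W | Ĉ(w) = L̂(w)}`. -/
def hamiltonianSubmanifold (hk : 1 ≤ k) (L : Jet n π k → ℝ) : Set (JetMomentum n π k) :=
  {w | w ∈ extendedBundle n π k ∧ coupling w = L (w.1.proj (by omega))}

/-- The submanifold `W_1` of `W_o`: the graph of the extended Legendre–Ostrogradsky map. -/
def legendreGraph (hk : 1 ≤ k) (L : Jet n π k → ℝ) : Set (JetMomentum n π k) :=
  {w | w.2 = extendedLegendre hk L w.1}

/-- The projection `ρ̂_2 = μ ∘ ρ_2` to `J^{k-1} π^*`. -/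
def toRestricted (w : JetMomentum n π k) : RestrictedJet n π (k - 1) := quotientMap w.2

/-- The `2`-form `ρ_2^* Ω_{k-1}`, which is `Ω_o` on vectors tangent to `W_o`. -/
def unifiedForm (w : JetMomentum n π k) (u v : TangentSpace (jetMomentumModel n k) w) : ℝ :=
  pullbackTwo (I := jetMomentumModel n k) (I' := cotangentModel n (k - 1)) Prod.snd
    canonicalForm w u v

/-- `X ∈ 𝔛_{W_1}(W_o)` (a smooth vector field in `W_o` at support on `W_1`) is a solution of
`i(X) Ω_o |_{W_1} = 0`, `i(X) (ρ_ℝ^o)^* η |_{W_1} = 1`. -/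
structure IsUnifiedSolution (hk : 1 ≤ k) (L : Jet n π k → ℝ)
    (X : ∀ w : legendreGraph hk L, TangentSpace (jetMomentumModel n k) (w : JetMomentum n π k)) :
    Prop where
  smooth : IsSmoothAlong (jetMomentumModel n k) (legendreGraph hk L) X
  mem_tangent : ∀ w : legendreGraph hk L,
    X w ∈ tangentSet (jetMomentumModel n k) (hamiltonianSubmanifold hk L) w.1
  contraction : ∀ w : legendreGraph hk L,
    ∀ v ∈ tangentSet (jetMomentumModel n k) (hamiltonianSubmanifold hk L) w.1,
      unifiedForm w.1 (X w) v = 0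
  time : ∀ w : legendreGraph hk L,
    mfderiv (jetMomentumModel n k) 𝓘(ℝ, ℝ) (fun w : JetMomentum n π k => w.1.time) w.1 (X w) = (1 : ℝ)

/-- `X` is tangent to `W_1`. -/
def IsTangentToGraph (hk : 1 ≤ k) (L : Jet n π k → ℝ)
    (X : ∀ w : legendreGraph hk L, TangentSpace (jetMomentumModel n k) (w : JetMomentum n π k)) :
    Prop :=
  ∀ w : legendreGraph hk L, X w ∈ tangentSet (jetMomentumModel n k) (legendreGraph hk L) w.1

end Unified

/-! ### The Hamiltonian formalism -/

section Hamiltonian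

variable {n : ℕ} {E : Type*} [TopologicalSpace E]
  [ChartedSpace (EuclideanSpace ℝ (Fin (n + 1))) E] {π : E → ℝ} [IsFibredOverLine n π] {k : ℕ}

/-- The covector with vertical part `a` and no `dt` component in the chosen induced coordinates,
a representative of the class `a`. -/
def representative (a : RestrictedJet n π k) : CotangentJet n π k :=
  ⟨a.1, ContinuousLinearMap.comp (a.2 : (Fin (k + 1) → Fin n → ℝ) →L[ℝ] ℝ)
    (ContinuousLinearMap.snd ℝ ℝ (Fin (k + 1) → Fin n → ℝ))⟩

lemma quotientMap_representative (a : RestrictedJet n π k) :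
    quotientMap (representative a) = a := by
  rfl

/-- The `T*(J^{k-1} π)`-component of the Hamiltonian section `ĥ` of `W → W_r` at `(ȳ, a)`: the
covector `β` with `μ(β) = a` and `(ȳ, β) ∈ W_o`. -/
def liftToHamiltonian (hk : 1 ≤ k) (L : Jet n π k → ℝ) (y : Jet n π (2 * k - 1))
    (a : RestrictedJet n π (k - 1)) : CotangentJet n π (k - 1) :=
  let β : TangentSpace 𝓘(ℝ, JetCoord n (k - 1)) a.1 →L[ℝ] ℝ := (representative a).2
  ⟨a.1, β + (L (y.proj (by omega)) - coupling (y, representative a)) • Jet.dt a.1⟩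

/-- The Hamiltonian section `h` of `μ`, for a hyperregular Lagrangian:
`h(a) = ρ_2 (ĥ (FL⁻¹(a), a))`. -/
def hamiltonianSection (hk : 1 ≤ k) (L : Jet n π k → ℝ) (a : RestrictedJet n π (k - 1)) :
    CotangentJet n π (k - 1) :=
  liftToHamiltonian hk L (Function.invFun (restrictedLegendre hk L) a) a

/-- The Hamilton–Cartan form `Ω_h = h^* Ω_{k-1}` on `J^{k-1} π^*`. -/
def hamiltonCartanForm (hk : 1 ≤ k) (L : Jet n π k → ℝ) (a : RestrictedJet n π (k - 1))
    (u v : TangentSpace (restrictedModel n (k - 1)) a) : ℝ :=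
  pullbackTwo (I := restrictedModel n (k - 1)) (I' := cotangentModel n (k - 1))
    (hamiltonianSection hk L) canonicalForm a u v

/-- `X` is a smooth vector field on `J^{k-1} π^*` with `i(X) Ω_h = 0` and `i(X) τ̄^* η = 1`. -/
structure IsHamiltonianSolution (hk : 1 ≤ k) (L : Jet n π k → ℝ)
    (X : ∀ a : RestrictedJet n π (k - 1), TangentSpace (restrictedModel n (k - 1)) a) : Prop where
  smooth : ContMDiff (restrictedModel n (k - 1)) (restrictedModel n (k - 1)).tangent ∞
    (fun a => (⟨a, X a⟩ : TangentBundle (restrictedModel n (k - 1)) (RestrictedJet n π (k - 1))))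
  contraction : ∀ a v, hamiltonCartanForm hk L a (X a) v = 0
  time : ∀ a, mfderiv (restrictedModel n (k - 1)) 𝓘(ℝ, ℝ)
    (fun a : RestrictedJet n π (k - 1) => a.proj.time) a (X a) = (1 : ℝ)

/-- `X_h ∘ ρ̂_2 = Tρ̂_2 ∘ X_o` on `W_1`. -/
def IsProjectedTo (hk : 1 ≤ k) (L : Jet n π k → ℝ)
    (Xo : ∀ w : legendreGraph hk L, TangentSpace (jetMomentumModel n k) (w : JetMomentum n π k))
    (Xh : ∀ a : RestrictedJet n π (k - 1), TangentSpace (restrictedModel n (k - 1)) a) : Prop :=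
  ∀ w : legendreGraph hk L, Xh (toRestricted w.1) =
    mfderiv (jetMomentumModel n k) (restrictedModel n (k - 1))
      (toRestricted : JetMomentum n π k → RestrictedJet n π (k - 1)) w.1 (Xo w)

end Hamiltonian

end HOMech
end

/-! The map `y ↦ (y, FL~(y))`, with `FL~` the extended Legendre map, parametrizes `W_1` by `J^{2k-1}
π`. A field tangent to `W_1` is therefore `(v, T FL~ · v)` for a field `v` on `J^{2k-1} π`
(`eq_graphField_baseField`), and hyperregularity transports `v` to `J^{k-1} π^*` and back. Because
`h ∘ FL = FL~` (`hamiltonianSection_restrictedLegendre`), pulling `Ω_h` back by `FL` gives `FL~^* Ω`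
(`hamiltonCartanForm_apply`). Both systems thus become `i(v) FL~^* Ω = 0`, `dt(v) = 1`, except that
the unified contraction tests all vectors tangent to `W_o`, not only those tangent to `W_1`.

This gap is closed by `snd_eq_of_mfderiv_quotientMap_eq`. The form `Ω_o` sees only the component of
a vector in `T*(J^{k-1} π)`. As `T FL` is onto, a vector tangent to `W_o` at a point of `W_1` has
the same image under `Tμ` as some vector tangent to `W_1`, so their components differ by some `c
dt`. Differentiating `Ĉ = L` along both gives `c + p^{k-1} · δq_k = ∂L/∂q_k · δq_k`, and `p^{k-1} =
∂L/∂q_k` forces `c = 0`.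

For uniqueness, the difference of two Hamiltonian solutions, seen in `T*(J^{k-1} π)`, has no `dt`
component and is `Ω`-orthogonal to the image of `Th`, a hyperplane complementary to the fibre
direction `dt`. It is also orthogonal to that direction, hence zero since `Ω` is nondegenerate
(`eq_zero_of_forall_canonical_eq_zero`). A unified solution tangent to `W_1` projects to a
Hamiltonian one, and `T FL` is injective, so uniqueness passes to the unified side.

Only two facts about the explicit momenta are used: `p + p^r q_{r+1} = L` and `p^{k-1} = ∂L/∂q_k`.
Smoothness of `FL~` comes from that of `FL` and `L`, so the lower momenta are never computed. -/

noncomputable section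

namespace HOMech

/-! ### Cotangent and restricted bundles in bundle charts; the canonical form in coordinates -/

section BundleCoordinates

variable {n : ℕ} {E : Type*} [TopologicalSpace E]
  [ChartedSpace (EuclideanSpace ℝ (Fin (n + 1))) E] {π : E → ℝ} [IsFibredOverLine n π] {k : ℕ}

variable (n π k) in
/-- The fibres of `T*(J^k π)`. -/
abbrev CotangentFiber (x : Jet n π k) : Type _ :=
  TangentSpace 𝓘(ℝ, JetCoord n k) x →L[ℝ] Bundle.Trivial (Jet n π k) ℝ x

/-- The momenta of a covector in the induced coordinates around `x₀`. -/
lemma trivializationAt_cotangent (x₀ : Jet n π k) (α : CotangentJet n π k)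
    (h : α.1 ∈ (chartAt (JetCoord n k) x₀).source) :
    (trivializationAt (JetCoord n k →L[ℝ] ℝ) (CotangentFiber n π k) x₀ α).2 =
      ContinuousLinearMap.comp (α.2 : JetCoord n k →L[ℝ] ℝ)
        (tangentCoordChange 𝓘(ℝ, JetCoord n k) x₀ α.1 α.1) := by
  rw [hom_trivializationAt_apply]
  refine ContinuousLinearMap.ext fun v => ?_
  change (Bundle.Trivialization.continuousLinearMapAt ℝ
    (trivializationAt ℝ (Bundle.Trivial (Jet n π k) ℝ) x₀) α.1)
    (α.2 (Bundle.Trivialization.symmL ℝ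
      (trivializationAt (JetCoord n k) (TangentSpace 𝓘(ℝ, JetCoord n k)) x₀) α.1 v)) = _
  rw [TangentBundle.symmL_trivializationAt_eq_core h]
  exact DFunLike.congr_fun
    (Bundle.Trivial.continuousLinearMapAt_trivialization ℝ (Jet n π k) ℝ α.1) _

lemma trivializationAt_restricted (x₀ : Jet n π k) (a : RestrictedJet n π k) :
    (trivializationAt ((Fin (k + 1) → Fin n → ℝ) →L[ℝ] ℝ) (restrictedCore n π k).Fiber x₀ a).2 =
      ContinuousLinearMap.comp (a.2 : (Fin (k + 1) → Fin n → ℝ) →L[ℝ] ℝ)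
        (verticalChange n π k (achart _ x₀) (achart _ a.1) a.1) := by
  rfl

/-- Changes of jet coordinates preserve vertical vectors, so restricting a covector to them commutes
with changing chart: `μ` has the same linear expression in every induced chart, which yields its
smoothness and its derivative. -/
lemma trivializationAt_quotientMap (x₀ : Jet n π k) (α : CotangentJet n π k)
    (h : α.1 ∈ (chartAt (JetCoord n k) x₀).source) :
    (trivializationAt ((Fin (k + 1) → Fin n → ℝ) →L[ℝ] ℝ) (restrictedCore n π k).Fiber x₀
      (quotientMap α)).2 =
      ContinuousLinearMap.comp
        (trivializationAt (JetCoord n k →L[ℝ] ℝ) (CotangentFiber n π k) x₀ α).2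
        (ContinuousLinearMap.inr ℝ ℝ (Fin (k + 1) → Fin n → ℝ)) := by
  rw [trivializationAt_restricted, trivializationAt_cotangent x₀ α h]
  ext1 w
  have h1 := verticalChange_spec (achart (JetCoord n k) x₀) (achart (JetCoord n k) α.1) h
    (mem_chart_source _ α.1) w
  exact (congrArg (α.2 : JetCoord n k →L[ℝ] ℝ) h1).symm

lemma contMDiff_quotientMap : ContMDiff (cotangentModel n k) (restrictedModel n k) ∞
    (quotientMap : CotangentJet n π k → RestrictedJet n π k) := by
  intro α
  have hid : ContMDiffAt (cotangentModel n k) (cotangentModel n k) ∞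
    (id : CotangentJet n π k → CotangentJet n π k) α := contMDiffAt_id
  rw [Bundle.contMDiffAt_totalSpace] at hid ⊢
  refine ⟨hid.1, ?_⟩
  have h1 := hid.2.clm_comp (contMDiffAt_const
    (c := ContinuousLinearMap.inr ℝ ℝ (Fin (k + 1) → Fin n → ℝ)))
  refine h1.congr_of_eventuallyEq ?_
  filter_upwards [hid.1.continuousAt.preimage_mem_nhds
    ((chartAt (JetCoord n k) α.1).open_source.mem_nhds (mem_chart_source _ α.1))] with β hβ
  exact trivializationAt_quotientMap α.1 β hβ

section TotalSpace

variable {B F : Type*} {Z : B → Type*} [TopologicalSpace B]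
    [NormedAddCommGroup F] [NormedSpace ℝ F] [TopologicalSpace (Bundle.TotalSpace F Z)]
    [∀ x, TopologicalSpace (Z x)] [FiberBundle F Z] {V : Type*} [NormedAddCommGroup V]
    [NormedSpace ℝ V] [ChartedSpace V B]

lemma extChartAt_totalSpace_apply (α β : Bundle.TotalSpace F Z)
    (hβ : β.1 ∈ (trivializationAt F Z α.1).baseSet) :
    extChartAt (𝓘(ℝ, V).prod 𝓘(ℝ, F)) α β =
      (extChartAt 𝓘(ℝ, V) α.1 β.1, (trivializationAt F Z α.1 β).2) := by
  rw [FiberBundle.extChartAt]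
  change (extChartAt 𝓘(ℝ, V) α.1 (trivializationAt F Z α.1 β).1, _) = _
  rw [(trivializationAt F Z α.1).coe_fst' hβ]
  rfl

lemma extChartAt_totalSpace_symm_proj (α : Bundle.TotalSpace F Z) {z : V × F}
    (hz : z ∈ (extChartAt (𝓘(ℝ, V).prod 𝓘(ℝ, F)) α).target) :
    ((extChartAt (𝓘(ℝ, V).prod 𝓘(ℝ, F)) α).symm z).1 = (extChartAt 𝓘(ℝ, V) α.1).symm z.1 ∧
    z.1 ∈ (extChartAt 𝓘(ℝ, V) α.1).target ∧
    (trivializationAt F Z α.1 ((extChartAt (𝓘(ℝ, V).prod 𝓘(ℝ, F)) α).symm z)).2 = z.2 := by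
  rw [FiberBundle.extChartAt_target] at hz
  have h1 : (extChartAt 𝓘(ℝ, V) α.1).symm z.1 ∈ (trivializationAt F Z α.1).baseSet := hz.1.2
  have h0 : (extChartAt (𝓘(ℝ, V).prod 𝓘(ℝ, F)) α).symm z =
      (trivializationAt F Z α.1).toOpenPartialHomeomorph.symm
        ((extChartAt 𝓘(ℝ, V) α.1).symm z.1, z.2) := by
    rw [FiberBundle.extChartAt]
    rfl
  refine ⟨?_, hz.1.1, ?_⟩
  · rw [h0]
    exact Bundle.Trivialization.proj_symm_apply' _ h1
  · rw [h0, Bundle.Trivialization.apply_symm_apply' _ h1]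

lemma mfderiv_totalSpace_proj (α : Bundle.TotalSpace F Z) :
    mfderiv (𝓘(ℝ, V).prod 𝓘(ℝ, F)) 𝓘(ℝ, V) (Bundle.TotalSpace.proj : Bundle.TotalSpace F Z → B) α
      = ContinuousLinearMap.fst ℝ V F := by
  have h : HasMFDerivAt (𝓘(ℝ, V).prod 𝓘(ℝ, F)) 𝓘(ℝ, V)
      (Bundle.TotalSpace.proj : Bundle.TotalSpace F Z → B) α
      (ContinuousLinearMap.fst ℝ V F) := by
    refine ⟨(FiberBundle.continuous_proj F Z).continuousAt, ?_⟩
    refine HasFDerivAt.hasFDerivWithinAt ?_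
    refine (ContinuousLinearMap.fst ℝ V F).hasFDerivAt.congr_of_eventuallyEq ?_
    filter_upwards [extChartAt_target_mem_nhds (I := 𝓘(ℝ, V).prod 𝓘(ℝ, F)) α] with z hz
    obtain ⟨h1, h2, -⟩ := extChartAt_totalSpace_symm_proj (V := V) α hz
    simp only [writtenInExtChartAt, Function.comp_apply, h1]
    exact (extChartAt 𝓘(ℝ, V) α.1).right_inv h2
  exact h.mfderiv

end TotalSpace

/-- In the bundle charts at `α` and at `μ(α)` the map `μ` is linear near `α`, so it is its own
derivative. -/
lemma mfderiv_quotientMap (α : CotangentJet n π k) :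
    mfderiv (cotangentModel n k) (restrictedModel n k)
      (quotientMap : CotangentJet n π k → RestrictedJet n π k) α =
      (ContinuousLinearMap.id ℝ (JetCoord n k)).prodMap
        ((ContinuousLinearMap.compL ℝ (Fin (k + 1) → Fin n → ℝ) (JetCoord n k) ℝ).flip
          (ContinuousLinearMap.inr ℝ ℝ (Fin (k + 1) → Fin n → ℝ))) := by
  set Λ := (ContinuousLinearMap.id ℝ (JetCoord n k)).prodMap
        ((ContinuousLinearMap.compL ℝ (Fin (k + 1) → Fin n → ℝ) (JetCoord n k) ℝ).flip
          (ContinuousLinearMap.inr ℝ ℝ (Fin (k + 1) → Fin n → ℝ)))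
  have h : HasMFDerivAt (cotangentModel n k) (restrictedModel n k)
      (quotientMap : CotangentJet n π k → RestrictedJet n π k) α Λ := by
    refine ⟨contMDiff_quotientMap.continuous.continuousAt, ?_⟩
    refine HasFDerivAt.hasFDerivWithinAt ?_
    refine Λ.hasFDerivAt.congr_of_eventuallyEq ?_
    filter_upwards [extChartAt_target_mem_nhds (I := cotangentModel n k) α] with z hz
    obtain ⟨h1, h2, h3⟩ := extChartAt_totalSpace_symm_proj (V := JetCoord n k) α hz
    set β := (extChartAt (cotangentModel n k) α).symm z
    have h4 : β.1 ∈ (chartAt (JetCoord n k) α.1).source := by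
      rw [h1, ← extChartAt_source 𝓘(ℝ, JetCoord n k)]
      exact (extChartAt 𝓘(ℝ, JetCoord n k) α.1).map_target h2
    have h5 := extChartAt_totalSpace_apply (V := JetCoord n k) (quotientMap α) (quotientMap β) h4
    change extChartAt (restrictedModel n k) (quotientMap α) (quotientMap β) = Λ z
    rw [h5]
    refine Prod.ext ?_ ?_
    · change extChartAt 𝓘(ℝ, JetCoord n k) α.1 β.1 = z.1
      rw [h1]
      exact (extChartAt 𝓘(ℝ, JetCoord n k) α.1).right_inv h2
    · exact (trivializationAt_quotientMap α.1 β h4).trans (by rw [h3]; rfl)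
  exact h.mfderiv

/-- Each tangent space is read in the preferred chart of its own base point, so the inverse of a
fixed chart has as derivative a change of coordinates, not the identity. -/
lemma mfderiv_extChartAt_symm_jet (x : Jet n π k) {z : JetCoord n k}
    (hz : z ∈ (extChartAt 𝓘(ℝ, JetCoord n k) x).target) :
    mfderiv 𝓘(ℝ, JetCoord n k) 𝓘(ℝ, JetCoord n k) (extChartAt 𝓘(ℝ, JetCoord n k) x).symm z =
      tangentCoordChange 𝓘(ℝ, JetCoord n k) x ((extChartAt 𝓘(ℝ, JetCoord n k) x).symm z)
        ((extChartAt 𝓘(ℝ, JetCoord n k) x).symm z) := by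
  have h1 := (extChartAt 𝓘(ℝ, JetCoord n k) x).map_target hz
  rw [extChartAt_source] at h1
  have h2 := TangentBundle.symmL_trivializationAt (I := 𝓘(ℝ, JetCoord n k)) h1
  rw [TangentBundle.symmL_trivializationAt_eq_core h1] at h2
  rw [(extChartAt 𝓘(ℝ, JetCoord n k) x).right_inv hz] at h2
  simp only [modelWithCornersSelf_coe, range_id, mfderivWithin_univ] at h2
  exact h2.symm

/-- The form `p dq` depends linearly on the point `(q, p)`, so its derivative in the direction `u`
is the same expression with `p` replaced by the momentum part of `u`. -/
lemma fderiv_comp_fst_of_eventuallyEq {V : Type*} [NormedAddCommGroup V] [NormedSpace ℝ V]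
    {θ : V × (V →L[ℝ] ℝ) → (V × (V →L[ℝ] ℝ) →L[ℝ] ℝ)} {x : V × (V →L[ℝ] ℝ)}
    (h : θ =ᶠ[𝓝 x] fun z => z.2.comp (ContinuousLinearMap.fst ℝ V (V →L[ℝ] ℝ)))
    (u v : V × (V →L[ℝ] ℝ)) : fderiv ℝ θ x u v = u.2 v.1 := by
  have h1 := (((ContinuousLinearMap.compL ℝ (V × (V →L[ℝ] ℝ)) V ℝ).flip
        (ContinuousLinearMap.fst ℝ V (V →L[ℝ] ℝ))).comp
          (ContinuousLinearMap.snd ℝ V (V →L[ℝ] ℝ))).hasFDerivAt (x := x)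
  rw [(h1.congr_of_eventuallyEq h).fderiv]
  rfl

/-- Darboux expression of `Ω`: in the bundle chart at `α` the tautological form is `p dq`. From here
on `Ω` is pure linear algebra on the model space. -/
lemma canonicalForm_apply (α : CotangentJet n π k)
    (u v : JetCoord n k × (JetCoord n k →L[ℝ] ℝ)) :
    canonicalForm α u v = v.2 u.1 - u.2 v.1 := by
  set ψ := extChartAt (cotangentModel n k) α with hψ
  let θ : JetCoord n k × (JetCoord n k →L[ℝ] ℝ) →
      (JetCoord n k × (JetCoord n k →L[ℝ] ℝ) →L[ℝ] ℝ) := fun z =>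
    (tautologicalForm (ψ.symm z)).comp
      (mfderiv 𝓘(ℝ, JetCoord n k × (JetCoord n k →L[ℝ] ℝ)) (cotangentModel n k) ψ.symm z)
  -- The derivative of the base chart inverse is the coordinate change `x₀ → x`, and the fibre
  -- coordinate of a covector is its composite with that same change; the two fit together to give
  -- `p dq`.
  have key : θ =ᶠ[𝓝 (ψ α)] fun z => z.2.comp (ContinuousLinearMap.fst ℝ _ _) := by
    filter_upwards [(isOpen_extChartAt_target (I := cotangentModel n k) α).mem_nhds
      (mem_extChartAt_target (I := cotangentModel n k) α)] with z hz
    have hz' := (isOpen_extChartAt_target (I := cotangentModel n k) α).mem_nhds hz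
    obtain ⟨h1, h2, h3⟩ := extChartAt_totalSpace_symm_proj (V := JetCoord n k) α hz
    change (ψ.symm z).1 = _ at h1
    have h2' := (isOpen_extChartAt_target (I := 𝓘(ℝ, JetCoord n k)) α.1).mem_nhds h2
    have h4 : (ψ.symm z).1 ∈ (chartAt (JetCoord n k) α.1).source := by
      rw [h1, ← extChartAt_source 𝓘(ℝ, JetCoord n k)]
      exact (extChartAt 𝓘(ℝ, JetCoord n k) α.1).map_target h2
    have hd1 : MDifferentiableAt 𝓘(ℝ, JetCoord n k × (JetCoord n k →L[ℝ] ℝ))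
        (cotangentModel n k) ψ.symm z :=
      ((contMDiffOn_extChartAt_symm (n := ∞) α).contMDiffAt hz').mdifferentiableAt (by simp)
    have hd2 : MDifferentiableAt (cotangentModel n k) 𝓘(ℝ, JetCoord n k)
        (Bundle.TotalSpace.proj : CotangentJet n π k → Jet n π k) (ψ.symm z) :=
      (Bundle.contMDiffAt_proj (n := ∞) _).mdifferentiableAt (by simp)
    have hd3 : MDifferentiableAt 𝓘(ℝ, JetCoord n k) 𝓘(ℝ, JetCoord n k)
        (extChartAt 𝓘(ℝ, JetCoord n k) α.1).symm z.1 :=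
      ((contMDiffOn_extChartAt_symm (n := ∞) α.1).contMDiffAt h2').mdifferentiableAt (by simp)
    have e1 := mfderiv_comp z hd2 hd1
    have e2 : mfderiv 𝓘(ℝ, JetCoord n k × (JetCoord n k →L[ℝ] ℝ)) 𝓘(ℝ, JetCoord n k)
        (Bundle.TotalSpace.proj ∘ ψ.symm) z = mfderiv 𝓘(ℝ, JetCoord n k × (JetCoord n k →L[ℝ] ℝ))
        𝓘(ℝ, JetCoord n k) ((extChartAt 𝓘(ℝ, JetCoord n k) α.1).symm ∘ Prod.fst) z := by
      apply Filter.EventuallyEq.mfderiv_eq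
      filter_upwards [hz'] with y hy
      exact (extChartAt_totalSpace_symm_proj (V := JetCoord n k) α hy).1
    have hd4 : MDifferentiableAt 𝓘(ℝ, JetCoord n k × (JetCoord n k →L[ℝ] ℝ)) 𝓘(ℝ, JetCoord n k)
        (Prod.fst : JetCoord n k × (JetCoord n k →L[ℝ] ℝ) → JetCoord n k) z :=
      differentiableAt_fst.mdifferentiableAt
    have e3 := mfderiv_comp z hd3 hd4
    have e4 : mfderiv 𝓘(ℝ, JetCoord n k × (JetCoord n k →L[ℝ] ℝ)) 𝓘(ℝ, JetCoord n k)
        (Prod.fst : JetCoord n k × (JetCoord n k →L[ℝ] ℝ) → JetCoord n k) z =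
        ContinuousLinearMap.fst ℝ (JetCoord n k) (JetCoord n k →L[ℝ] ℝ) :=
      (hasFDerivAt_fst (p := z)).hasMFDerivAt.mfderiv
    rw [e4, mfderiv_extChartAt_symm_jet α.1 h2] at e3
    -- The fibre coordinate `z.2` is now the covector composed with the change of coordinates that
    -- also occurs in `e3`.
    rw [trivializationAt_cotangent α.1 _ h4, h1] at h3
    refine ContinuousLinearMap.ext fun w => ?_
    have e5 := DFunLike.congr_fun (e1.symm.trans (e2.trans e3)) w
    exact (congrArg ((ψ.symm z).2 : JetCoord n k →L[ℝ] ℝ) e5).trans (DFunLike.congr_fun h3 w.1)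
  change -(fderiv ℝ θ (ψ α) u v - fderiv ℝ θ (ψ α) v u) = _
  have h1 := fderiv_comp_fst_of_eventuallyEq (V := JetCoord n k) key
  rw [h1, h1]
  ring

end BundleCoordinates

/-! ### Smooth maps between jet manifolds, derivatives of prolongations and the coupling function -/

section JetCalculus

variable {n : ℕ} {E : Type*} [TopologicalSpace E]
  [ChartedSpace (EuclideanSpace ℝ (Fin (n + 1))) E] {π : E → ℝ} {N r : ℕ}

lemma Jet.point_proj (hr : r ≤ N) (y : Jet n π N) : (y.proj hr).point = y.point := by
  induction y using Quotient.inductionOn with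
  | h p => rfl

lemma Jet.coord_proj (hr : r ≤ N) {e : OpenPartialHomeomorph E (ℝ × (Fin n → ℝ))}
    (he : IsAdaptedChart n π e) (y : Jet n π N) (hy : y.point ∈ e.source) :
    coord e (y.proj hr) = truncate hr (coord e y) := by
  induction y using Quotient.inductionOn with
  | h p =>
    rw [Jet.coord_mk he p hy]
    exact (Jet.coord_mk (k := r) he p hy).trans rfl

lemma Jet.time_out (y : Jet n π N) : y.out.1.1 = y.time := by
  conv_rhs => rw [← Quotient.out_eq y]
  rfl

/-- The coordinates `(1, q_1^A, …, q_{r+1}^A)` of the total time derivative along the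
projection onto the `r`-jets. -/
def shift (h : r + 1 ≤ N) (x : JetCoord n N) : JetCoord n r :=
  (1, fun i => x.2 ⟨i + 1, by omega⟩)

lemma contDiff_truncate (h : r ≤ N) : ContDiff ℝ ∞ (truncate h : JetCoord n N → JetCoord n r) := by
  unfold truncate
  fun_prop

lemma contDiff_shift (h : r + 1 ≤ N) : ContDiff ℝ ∞ (shift h : JetCoord n N → JetCoord n r) := by
  unfold shift
  fun_prop

/-- Differentiating `q_i = d^i φ / dt^i` gives `q_{i+1}`; the velocity of the `r`-jet thus depends
only on the `(r+1)`-jet, whence `r + 1 ≤ N`. -/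
lemma hasDerivAt_sectionCoord (h : r + 1 ≤ N) (p : PointedSection n π)
    {e : OpenPartialHomeomorph E (ℝ × (Fin n → ℝ))} (he : IsAdaptedChart n π e)
    (hp : p.1.2 p.1.1 ∈ e.source) :
    HasDerivAt (fun s => sectionCoord r e (s, p.1.2)) (shift h (sectionCoord N e p.1)) p.1.1 := by
  refine (hasDerivAt_id p.1.1).prodMk (hasDerivAt_pi.2 fun i => ?_)
  have h1 : ContDiffAt ℝ ∞ (fun s => (e (p.1.2 s)).2) p.1.1 := (p.contDiffAt he hp).snd
  have h2 : DifferentiableAt ℝ (iteratedDeriv i fun s => (e (p.1.2 s)).2) p.1.1 := by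
    rw [iteratedDeriv_eq_equiv_comp]
    refine (LinearIsometryEquiv.differentiable _ _).comp _ ?_
    exact (h1.iteratedFDeriv_right (m := 1) (by exact_mod_cast le_top)).differentiableAt (by simp)
  have h3 := h2.hasDerivAt
  rw [← iteratedDeriv_succ] at h3
  exact h3

variable [IsFibredOverLine n π]

lemma Jet.extChartAt_apply (x y : Jet n π N) :
    extChartAt 𝓘(ℝ, JetCoord n N) x y = coord (adaptedChartAt π x.point) y := rfl

lemma Jet.mem_extChartAt_source {x y : Jet n π N} :
    y ∈ (extChartAt 𝓘(ℝ, JetCoord n N) x).source ↔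
      y.point ∈ (adaptedChartAt (n := n) π x.point).source := by
  rw [extChartAt_source]
  rfl

/-- A map into a jet manifold is smooth if its coordinates are. -/
lemma Jet.contMDiffAt_of_coord {V H M : Type*} [NormedAddCommGroup V] [NormedSpace ℝ V]
    [TopologicalSpace H] {I : ModelWithCorners ℝ V H} [TopologicalSpace M] [ChartedSpace H M]
    {f : M → Jet n π N} {x : M}
    (hs : ∀ᶠ z in 𝓝 x, (f z).point ∈ (adaptedChartAt (n := n) π (f x).point).source)
    (hf : ContMDiffAt I 𝓘(ℝ, JetCoord n N) ∞
      (fun z => coord (adaptedChartAt π (f x).point) (f z)) x) :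
    ContMDiffAt I 𝓘(ℝ, JetCoord n N) ∞ f x := by
  have h1 : ContMDiffAt 𝓘(ℝ, JetCoord n N) 𝓘(ℝ, JetCoord n N) ∞
      (extChartAt 𝓘(ℝ, JetCoord n N) (f x)).symm (coord (adaptedChartAt π (f x).point) (f x)) :=
    (contMDiffOn_extChartAt_symm (n := ∞) (f x)).contMDiffAt
      (extChartAt_target_mem_nhds (I := 𝓘(ℝ, JetCoord n N)) (f x))
  refine (h1.comp x hf).congr_of_eventuallyEq ?_
  filter_upwards [hs] with z hz
  exact ((extChartAt 𝓘(ℝ, JetCoord n N) (f x)).left_inv (Jet.mem_extChartAt_source.2 hz)).symm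

lemma Jet.continuousAt_of_coord {M : Type*} [TopologicalSpace M] {f : M → Jet n π N} {x : M}
    (hs : ∀ᶠ z in 𝓝 x, (f z).point ∈ (adaptedChartAt (n := n) π (f x).point).source)
    (hf : ContinuousAt (fun z => coord (adaptedChartAt π (f x).point) (f z)) x) :
    ContinuousAt f x := by
  have h1 : ContinuousAt (extChartAt 𝓘(ℝ, JetCoord n N) (f x)).symm
      (coord (adaptedChartAt π (f x).point) (f x)) :=
    continuousAt_extChartAt_symm (f x)
  refine (h1.comp (f := fun z => coord (adaptedChartAt π (f x).point) (f z)) hf).congr ?_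
  filter_upwards [hs] with z hz
  exact (extChartAt 𝓘(ℝ, JetCoord n N) (f x)).left_inv (Jet.mem_extChartAt_source.2 hz)

lemma Jet.eventually_point_mem (y : Jet n π N) :
    ∀ᶠ z in 𝓝 y, z.point ∈ (adaptedChartAt (n := n) π y.point).source := by
  filter_upwards [extChartAt_source_mem_nhds (I := 𝓘(ℝ, JetCoord n N)) y] with z hz
  exact Jet.mem_extChartAt_source.1 hz

lemma Jet.contMDiffAt_coord (y : Jet n π N) :
    ContMDiffAt 𝓘(ℝ, JetCoord n N) 𝓘(ℝ, JetCoord n N) ∞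
      (coord (adaptedChartAt π y.point) : Jet n π N → JetCoord n N) y :=
  contMDiffAt_extChartAt

lemma Jet.contMDiff_proj (hr : r ≤ N) :
    ContMDiff 𝓘(ℝ, JetCoord n N) 𝓘(ℝ, JetCoord n r) ∞ (Jet.proj hr : Jet n π N → Jet n π r) := by
  intro y
  have h := Jet.eventually_point_mem y
  refine Jet.contMDiffAt_of_coord ?_ ?_
  · simpa only [Jet.point_proj] using h
  · rw [Jet.point_proj]
    refine (((contDiff_truncate hr).contMDiff.contMDiffAt).comp y
      (Jet.contMDiffAt_coord y)).congr_of_eventuallyEq ?_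
    filter_upwards [h] with z hz
    exact Jet.coord_proj hr (isAdaptedChart_adaptedChartAt π _) z hz

lemma Jet.contMDiff_time :
    ContMDiff 𝓘(ℝ, JetCoord n N) 𝓘(ℝ, ℝ) ∞ (Jet.time : Jet n π N → ℝ) := by
  intro y
  refine (contDiff_fst.contMDiff.contMDiffAt.comp y (Jet.contMDiffAt_coord y)).congr_of_eventuallyEq
    (Eventually.of_forall fun z => ?_)
  exact (Jet.time_out z).symm

lemma prolongation_eq {φ : ℝ → E} {s : ℝ} (h : IsLocalSection n π φ s) :
    prolongation n π r φ s = Quotient.mk (jetSetoid n π r) ⟨(s, φ), h⟩ :=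
  dif_pos h

lemma prolongation_self (p : PointedSection n π) :
    prolongation n π r p.1.2 p.1.1 = Quotient.mk (jetSetoid n π r) p :=
  prolongation_eq p.2

lemma eventually_coord_prolongation (p : PointedSection n π)
    {e : OpenPartialHomeomorph E (ℝ × (Fin n → ℝ))} (he : IsAdaptedChart n π e)
    (hp : p.1.2 p.1.1 ∈ e.source) :
    ∀ᶠ s in 𝓝 p.1.1, (prolongation n π r p.1.2 s).point ∈ e.source ∧
      Jet.coord e (prolongation n π r p.1.2 s) = sectionCoord r e (s, p.1.2) := by
  filter_upwards [p.eventually_mem hp, eventually_eventually_nhds.2 p.2] with s hs hs'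
  rw [prolongation_eq hs']
  exact ⟨hs, Jet.coord_mk he ⟨(s, p.1.2), hs'⟩ hs⟩

lemma hasDerivAt_coord_prolongation (h : r + 1 ≤ N) (p : PointedSection n π)
    {e : OpenPartialHomeomorph E (ℝ × (Fin n → ℝ))} (he : IsAdaptedChart n π e)
    (hp : p.1.2 p.1.1 ∈ e.source) :
    HasDerivAt (fun s => Jet.coord e (prolongation n π r p.1.2 s))
      (shift h (sectionCoord N e p.1)) p.1.1 :=
  (hasDerivAt_sectionCoord h p he hp).congr_of_eventuallyEq
    ((eventually_coord_prolongation p he hp).mono fun _ hs => hs.2)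

/-- The velocity of a prolongation in the preferred chart of its base point. Continuity is proved
separately, through coordinates, because it is part of `HasMFDerivAt`. -/
lemma hasMFDerivAt_prolongation (h : r + 1 ≤ N) (p : PointedSection n π) :
    HasMFDerivAt 𝓘(ℝ, ℝ) 𝓘(ℝ, JetCoord n r) (prolongation n π r p.1.2) p.1.1
      (ContinuousLinearMap.toSpanSingleton ℝ
        (shift h (sectionCoord N (adaptedChartAt π (p.1.2 p.1.1)) p.1) : JetCoord n r)) := by
  have he := isAdaptedChart_adaptedChartAt (n := n) π (p.1.2 p.1.1)
  have hp := mem_adaptedChartAt_source (n := n) π (p.1.2 p.1.1)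
  have hpt : (prolongation n π r p.1.2 p.1.1).point = p.1.2 p.1.1 := by
    rw [prolongation_self]
    rfl
  have h1 := hasDerivAt_coord_prolongation (r := r) h p he hp
  refine ⟨?_, ?_⟩
  · refine Jet.continuousAt_of_coord ?_ ?_
    · rw [hpt]
      exact (eventually_coord_prolongation p he hp).mono fun _ hs => hs.1
    · rw [hpt]
      exact h1.continuousAt
  · have h2 : HasDerivAt (fun s => Jet.coord
        (adaptedChartAt π (prolongation n π r p.1.2 p.1.1).point) (prolongation n π r p.1.2 s))
        (shift h (sectionCoord N (adaptedChartAt π (p.1.2 p.1.1)) p.1)) p.1.1 := by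
      rw [hpt]
      exact h1
    exact h2.hasFDerivAt.hasFDerivWithinAt

/-- The total time derivative transforms as a tangent vector. -/
lemma tangentCoordChange_shift (h : r + 1 ≤ N) (y : Jet n π N) (x₀ x : Jet n π r)
    (hx : y.proj (by omega) = x)
    (h₀ : y.point ∈ (adaptedChartAt (n := n) π x₀.point).source) :
    tangentCoordChange 𝓘(ℝ, JetCoord n r) x₀ x x
      (shift h (Jet.coord (adaptedChartAt π x₀.point) y)) =
      shift h (Jet.coord (adaptedChartAt π y.point) y) := by
  have hxp : x.point = y.point := by rw [← hx, Jet.point_proj]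
  set p := y.out
  have hp : p.1.2 p.1.1 = y.point := Jet.point_out y
  have he := isAdaptedChart_adaptedChartAt (n := n) π y.point
  have he₀ := isAdaptedChart_adaptedChartAt (n := n) π x₀.point
  have hm := mem_adaptedChartAt_source (n := n) π y.point
  have hpx : prolongation n π r p.1.2 p.1.1 = x := by
    rw [prolongation_self, ← hx]
    conv_rhs => rw [← Quotient.out_eq y]
    rfl
  have d₀ := hasDerivAt_coord_prolongation (r := r) h p he₀ (by rwa [hp])
  have d := hasDerivAt_coord_prolongation (r := r) h p he (by rwa [hp])
  have hc := hasFDerivWithinAt_tangentCoordChange (I := 𝓘(ℝ, JetCoord n r)) (x := x₀) (y := x)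
    (z := x) ⟨Jet.mem_extChartAt_source.2 (by rwa [hxp]), mem_extChartAt_source x⟩
  simp only [modelWithCornersSelf_coe, range_id, hasFDerivWithinAt_univ] at hc
  have hc' : HasFDerivAt (extChartAt 𝓘(ℝ, JetCoord n r) x ∘ (extChartAt 𝓘(ℝ, JetCoord n r) x₀).symm)
      (tangentCoordChange 𝓘(ℝ, JetCoord n r) x₀ x x)
      (Jet.coord (adaptedChartAt π x₀.point) (prolongation n π r p.1.2 p.1.1)) := by
    rw [hpx]
    exact hc
  -- Both sides are velocities of one prolonged representative, in the charts around `x₀` and `x`;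
  -- the chain rule and uniqueness of derivatives identify them.
  refine (hc'.comp_hasDerivAt p.1.1 d₀).unique (d.congr_of_eventuallyEq ?_)
  filter_upwards [eventually_coord_prolongation (r := r) p he₀ (by rwa [hp])] with s hs
  change extChartAt 𝓘(ℝ, JetCoord n r) x ((extChartAt 𝓘(ℝ, JetCoord n r) x₀).symm
    (extChartAt 𝓘(ℝ, JetCoord n r) x₀ (prolongation n π r p.1.2 s))) = _
  rw [(extChartAt 𝓘(ℝ, JetCoord n r) x₀).left_inv (Jet.mem_extChartAt_source.2 hs.1),
    Jet.extChartAt_apply, hxp]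

variable {k : ℕ}

/-- The velocity of the chosen representative depends only on the jet, so the choice hidden in `out`
drops out and `Ĉ = p + p^r q_{r+1}`. -/
lemma coupling_apply (hk : 1 ≤ k) (w : JetMomentum n π k) :
    coupling w = (w.2.2 : JetCoord n (k - 1) →L[ℝ] ℝ)
      (shift (by omega) (Jet.coord (adaptedChartAt π w.1.point) w.1)) := by
  have h := (hasMFDerivAt_prolongation (r := k - 1) (N := 2 * k - 1) (by omega) w.1.out).mfderiv
  rw [Jet.point_out, Jet.time_out] at h
  have h1 := DFunLike.congr_fun h (1 : ℝ)
  refine congrArg (w.2.2 : JetCoord n (k - 1) →L[ℝ] ℝ) (h1.trans ?_)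
  exact one_smul ℝ _

/-- Covectors and velocities transform contragrediently, so `Ĉ` keeps its form in any chart. Fixing
the chart is what allows `Ĉ` to be differentiated as the point moves. -/
lemma coupling_eq_trivializationAt (hk : 1 ≤ k) (w : JetMomentum n π k)
    (hw : w ∈ extendedBundle n π k) (x₀ : Jet n π (k - 1))
    (h₀ : w.1.point ∈ (adaptedChartAt (n := n) π x₀.point).source) :
    coupling w =
      (trivializationAt (JetCoord n (k - 1) →L[ℝ] ℝ) (CotangentFiber n π (k - 1)) x₀ w.2).2
        (shift (by omega) (Jet.coord (adaptedChartAt π x₀.point) w.1)) := by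
  have hw' : w.1.proj (by omega : k - 1 ≤ 2 * k - 1) = w.2.1 := hw
  rw [coupling_apply hk, trivializationAt_cotangent]
  · exact congrArg (w.2.2 : JetCoord n (k - 1) →L[ℝ] ℝ)
      (tangentCoordChange_shift (by omega) w.1 x₀ w.2.1 hw' h₀).symm
  · rw [← hw', ← extChartAt_source 𝓘(ℝ, JetCoord n (k - 1)), Jet.mem_extChartAt_source,
      Jet.point_proj]
    exact h₀

end JetCalculus

/-! ### The Legendre covector, smoothness of the extended Legendre map and the Hamiltonian section
-/

section LegendreMap

variable {n k : ℕ}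

/-- A vector `v` with `dt(v) = 1` is transverse to the vertical vectors, so a covector is recovered
from its vertical part and its value on `v`. With `v` the total time derivative, this recovers the
`dt` component from `Ĉ`. -/
lemma covector_eq {r : ℕ} {A : JetCoord n r →L[ℝ] ℝ} {a : (Fin (r + 1) → Fin n → ℝ) →L[ℝ] ℝ}
    {l : ℝ} {v : JetCoord n r} (ha : A.comp (ContinuousLinearMap.inr ℝ ℝ _) = a) (hv : v.1 = 1)
    (hl : A v = l) :
    A = a.comp (ContinuousLinearMap.snd ℝ ℝ (Fin (r + 1) → Fin n → ℝ)) +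
      (l - a v.2) • ContinuousLinearMap.fst ℝ ℝ (Fin (r + 1) → Fin n → ℝ) := by
  refine ContinuousLinearMap.ext fun w => ?_
  have h1 : w = (0, w.2) + w.1 • (v - (0, v.2)) := by
    refine Prod.ext ?_ ?_
    · simp [hv]
    · simp
  have h2 : ∀ u, a u = A (0, u) := fun u => (DFunLike.congr_fun ha u).symm
  conv_lhs => rw [h1]
  simp only [map_add, map_smul, map_sub, hl, ← h2]
  simp [mul_comm]

/-- This is what `p = L - p^r q_{r+1}` is made for: the graph of the extended Legendre map lies in
`W_o`. -/
lemma legendreCovector_shift (hk : 1 ≤ k) (ℓ : JetCoord n k → ℝ)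
    (x : JetCoord n (2 * k - 1)) :
    legendreCovector hk ℓ x (shift (by omega) x) = ℓ (truncate (by omega) x) := by
  simp [legendreCovector, shift, dq]

/-- For `r = k - 1` the sum defining the momentum has the single term `i = 0`, so `p^{k-1} =
∂L/∂q_k`. A displacement in slot `k - 1` of the covector matches one in slot `k` of the Lagrangian.
-/
lemma legendreCovector_single_last (hk : 1 ≤ k) (ℓ : JetCoord n k → ℝ)
    (x : JetCoord n (2 * k - 1)) (d : Fin n → ℝ) :
    legendreCovector hk ℓ x (0, fun i => if (i : ℕ) = k - 1 then d else 0) =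
      fderiv ℝ ℓ (truncate (by omega) x) (0, fun i => if (i : ℕ) = k then d else 0) := by
  have h1 : ((0, fun i => if (i : ℕ) = k then d else 0) : JetCoord n k) =
      ∑ A, d A • partialQ k k A := by
    refine Prod.ext ?_ (funext fun i => funext fun B => ?_)
    · simp [partialQ, Prod.fst_sum]
    · by_cases hi : (i : ℕ) = k <;>
        simp [partialQ, Prod.snd_sum, hi, Finset.sum_apply, Pi.single_apply]
  have h2 : ∀ A, momentum hk ℓ x (Fin.last (k - 1)) A =
      fderiv ℝ ℓ (truncate (by omega) x) (partialQ k k A) := by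
    intro A
    have h3 : k - (k - 1) = 1 := by omega
    have h4 : k - 1 + 1 = k := by omega
    simp [momentum, h3, h4]
  have h5 : ∀ i : Fin (k - 1 + 1), (i : ℕ) = k - 1 ↔ i = Fin.last (k - 1) := fun i =>
    ⟨fun h => Fin.ext h, fun h => by rw [h]; rfl⟩
  rw [h1, map_sum]
  simp only [map_smul, ← h2, legendreCovector, add_apply, sum_apply, smul_apply,
    dq, h5]
  simp only [ContinuousLinearMap.comp_apply, ContinuousLinearMap.coe_fst',
    ContinuousLinearMap.coe_snd', ContinuousLinearMap.proj_apply, smul_eq_mul, mul_zero, zero_add]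
  rw [Finset.sum_eq_single (Fin.last (k - 1))]
  · simp [mul_comm]
  · intro i _ hi
    simp [hi]
  · simp

variable {E : Type*} [TopologicalSpace E]
  [ChartedSpace (EuclideanSpace ℝ (Fin (n + 1))) E] {π : E → ℝ} [IsFibredOverLine n π]

lemma jetChart_symm_truncate {r N : ℕ} (hr : r ≤ N)
    {e : OpenPartialHomeomorph E (ℝ × (Fin n → ℝ))} (he : IsAdaptedChart n π e) (y : Jet n π N)
    (hy : y.point ∈ e.source) :
    (jetChart r he).symm (truncate hr (y.coord e)) = y.proj hr := by
  rw [← Jet.coord_proj hr he y hy]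
  exact (jetChart r he).left_inv (show (y.proj hr).point ∈ e.source by rwa [Jet.point_proj])

variable (hk : 1 ≤ k) (L : Jet n π k → ℝ)

lemma mem_extendedBundle_legendre (y : Jet n π (2 * k - 1)) :
    (y, extendedLegendre hk L y) ∈ extendedBundle n π k := rfl

lemma coupling_extendedLegendre (y : Jet n π (2 * k - 1)) :
    coupling (y, extendedLegendre hk L y) = L (y.proj (by omega)) := by
  rw [coupling_apply hk]
  have hp := Jet.point_proj (by omega : k - 1 ≤ 2 * k - 1) y
  have hm := mem_adaptedChartAt_source (n := n) π y.point
  have h1 := legendreCovector_shift hk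
    (fun z => L ((jetChart k (isAdaptedChart_adaptedChartAt π
      (y.proj (by omega : k - 1 ≤ 2 * k - 1)).point)).symm z))
    (y.coord (adaptedChartAt π (y.proj (by omega : k - 1 ≤ 2 * k - 1)).point))
  have h2 := jetChart_symm_truncate (by omega : k ≤ 2 * k - 1) (isAdaptedChart_adaptedChartAt π
    (y.proj (by omega : k - 1 ≤ 2 * k - 1)).point) y (by rw [hp]; exact hm)
  simp only [h2] at h1
  rw [← h1]
  -- The preferred charts of `y` and of its projection agree, as they depend only on the common
  -- point of `E`.
  exact congrArg (fun x => (extendedLegendre hk L y).2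
    (shift (by omega) (Jet.coord (adaptedChartAt π x) y))) hp.symm

lemma legendreGraph_subset : legendreGraph hk L ⊆ hamiltonianSubmanifold hk L := by
  rintro ⟨y, α⟩ h
  obtain rfl : α = extendedLegendre hk L y := h
  exact ⟨mem_extendedBundle_legendre hk L y, coupling_extendedLegendre hk L y⟩

/-- The covector `FL~(y)` lies over `FL(y)` and satisfies `Ĉ = L`, and by `covector_eq` these two
properties determine it. -/
lemma liftToHamiltonian_restrictedLegendre (y : Jet n π (2 * k - 1)) :
    liftToHamiltonian hk L y (restrictedLegendre hk L y) = extendedLegendre hk L y := by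
  have h1 := coupling_extendedLegendre hk L y
  rw [coupling_apply hk] at h1
  have h2 := covector_eq (A := (extendedLegendre hk L y).2) rfl rfl h1
  refine congrArg (Bundle.TotalSpace.mk (y.proj (by omega : k - 1 ≤ 2 * k - 1))) ?_
  refine Eq.trans ?_ h2.symm
  rw [coupling_apply hk, Jet.dt_eq]
  rfl

/-- The Ostrogradsky formulas are written in a chart that varies with the point, so they do not show
smoothness directly. Instead, in a fixed trivialization the vertical part is that of `FL`, smooth by
assumption, and the `dt` component is `L` minus the pairing of that part with the `q_{r+1}`. -/
lemma contMDiff_extendedLegendre (hL : ContMDiff 𝓘(ℝ, JetCoord n k) 𝓘(ℝ, ℝ) ∞ L)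
    (hF : ContMDiff 𝓘(ℝ, JetCoord n (2 * k - 1)) (restrictedModel n (k - 1)) ∞
      (restrictedLegendre hk L)) :
    ContMDiff 𝓘(ℝ, JetCoord n (2 * k - 1)) (cotangentModel n (k - 1)) ∞
      (extendedLegendre hk L) := by
  intro y
  have h1 := Bundle.contMDiffAt_totalSpace.1 (hF y)
  rw [Bundle.contMDiffAt_totalSpace]
  refine ⟨Jet.contMDiff_proj (by omega) y, ?_⟩
  set x₀ : Jet n π (k - 1) := y.proj (by omega) with hx₀
  have hp : x₀.point = y.point := Jet.point_proj (by omega) y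
  have h2 : ContMDiffAt 𝓘(ℝ, JetCoord n (2 * k - 1)) 𝓘(ℝ, JetCoord n (2 * k - 1)) ∞
      (Jet.coord (adaptedChartAt π x₀.point) : Jet n π (2 * k - 1) → _) y := by
    rw [hp]
    exact Jet.contMDiffAt_coord y
  have h3 : ContMDiffAt 𝓘(ℝ, JetCoord n (2 * k - 1)) 𝓘(ℝ, Fin (k - 1 + 1) → Fin n → ℝ) ∞
      (fun z : Jet n π (2 * k - 1) =>
        (shift (by omega) (z.coord (adaptedChartAt π x₀.point)) : JetCoord n (k - 1)).2) y :=
    (contDiff_snd.comp (contDiff_shift (by omega))).contMDiff.contMDiffAt.comp y h2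
  have h4 : ContMDiffAt 𝓘(ℝ, JetCoord n (2 * k - 1)) 𝓘(ℝ, ℝ) ∞
      (fun z : Jet n π (2 * k - 1) => L (z.proj (by omega))) y :=
    (hL.comp (Jet.contMDiff_proj (by omega))) y
  have h5 := (h1.2.clm_comp (contMDiffAt_const
    (c := ContinuousLinearMap.snd ℝ ℝ (Fin (k - 1 + 1) → Fin n → ℝ)))).add
    ((h4.sub (h1.2.clm_apply h3)).smul (contMDiffAt_const
      (c := ContinuousLinearMap.fst ℝ ℝ (Fin (k - 1 + 1) → Fin n → ℝ))))
  -- The smooth map `h5` is the right-hand side of `covector_eq`, with `v` the total time derivative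
  -- in the fixed chart.
  refine h5.congr_of_eventuallyEq ?_
  filter_upwards [Jet.eventually_point_mem y] with z hz
  rw [← hp] at hz
  refine covector_eq (v := shift (by omega) (z.coord (adaptedChartAt π x₀.point))) ?_ rfl ?_
  · refine (trivializationAt_quotientMap x₀ (extendedLegendre hk L z) ?_).symm
    rw [← extChartAt_source 𝓘(ℝ, JetCoord n (k - 1)), Jet.mem_extChartAt_source]
    exact (Jet.point_proj (by omega : k - 1 ≤ 2 * k - 1) z).symm ▸ hz
  · rw [← coupling_extendedLegendre hk L z]
    exact (coupling_eq_trivializationAt hk _ (mem_extendedBundle_legendre hk L z) x₀ hz).symm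

lemma hamiltonianSection_restrictedLegendre
    (hF : Function.Injective (restrictedLegendre hk L)) (y : Jet n π (2 * k - 1)) :
    hamiltonianSection hk L (restrictedLegendre hk L y) = extendedLegendre hk L y := by
  rw [hamiltonianSection, Function.leftInverse_invFun hF,
    liftToHamiltonian_restrictedLegendre]

end LegendreMap

/-! ### Tangent vectors as velocities of curves; tangent vectors of graphs -/

section TangentSets

variable {V : Type*} [NormedAddCommGroup V] [NormedSpace ℝ V] {H : Type*} [TopologicalSpace H]
  {I : ModelWithCorners ℝ V H} {M : Type*} [TopologicalSpace M] [ChartedSpace H M]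
  {V' : Type*} [NormedAddCommGroup V'] [NormedSpace ℝ V'] {H' : Type*} [TopologicalSpace H']
  {I' : ModelWithCorners ℝ V' H'} {M' : Type*} [TopologicalSpace M'] [ChartedSpace H' M']

lemma tangentSet_mono {S T : Set M} (h : S ⊆ T) (w : M) : tangentSet I S w ⊆ tangentSet I T w := by
  rintro v ⟨γ, hγ, h0⟩
  exact ⟨γ, hγ.mono fun _ hs => ⟨hs.1, h hs.2⟩, h0⟩

lemma HasFDerivWithinAt.hasDerivAt_of_univ {f : ℝ → V} {A : ℝ →L[ℝ] V} {t : ℝ}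
    (h : HasFDerivWithinAt f A univ t) : HasDerivAt f (A 1) t :=
  (hasFDerivWithinAt_univ.1 h).hasDerivAt

lemma hasDerivAt_extChartAt_comp {γ : ℝ → M} {t : ℝ} (h : MDifferentiableAt 𝓘(ℝ, ℝ) I γ t) :
    HasDerivAt (fun s => extChartAt I (γ t) (γ s)) (mfderiv 𝓘(ℝ, ℝ) I γ t (1 : ℝ) : V) t := by
  have h2 := h.hasMFDerivAt.2
  simp only [modelWithCornersSelf_coe, range_id] at h2
  exact HasFDerivWithinAt.hasDerivAt_of_univ (V := V) h2

/-- The curve is a straight line in the chart at `x`. Equality is stated in the tangent bundle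
because the base point `γ 0` is only propositionally `x`. -/
lemma exists_curve {M : Type*} [TopologicalSpace M] [ChartedSpace V M] [IsManifold 𝓘(ℝ, V) ∞ M]
    (x : M) (u : V) :
    ∃ γ : ℝ → M, (∀ᶠ s in 𝓝 0, ContMDiffAt 𝓘(ℝ, ℝ) 𝓘(ℝ, V) ∞ γ s) ∧
      (⟨γ 0, mfderiv 𝓘(ℝ, ℝ) 𝓘(ℝ, V) γ 0 (1 : ℝ)⟩ : TangentBundle 𝓘(ℝ, V) M) =
        ⟨x, (u : TangentSpace 𝓘(ℝ, V) x)⟩ := by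
  let c : ℝ → V := fun s => extChartAt 𝓘(ℝ, V) x x + s • u
  have hc : ContDiff ℝ ∞ c := by fun_prop
  have hc0 : c 0 = extChartAt 𝓘(ℝ, V) x x := by simp [c]
  let γ : ℝ → M := fun s => (extChartAt 𝓘(ℝ, V) x).symm (c s)
  have hγ0 : γ 0 = x := by simp [γ, hc0]
  have hev : ∀ᶠ s in 𝓝 (0 : ℝ), c s ∈ (extChartAt 𝓘(ℝ, V) x).target := by
    refine hc.continuous.continuousAt.eventually ?_
    rw [hc0]
    exact extChartAt_target_mem_nhds x
  have hs : ∀ᶠ s in 𝓝 (0 : ℝ), ContMDiffAt 𝓘(ℝ, ℝ) 𝓘(ℝ, V) ∞ γ s := by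
    filter_upwards [hev] with s hs
    exact ((contMDiffOn_extChartAt_symm (n := ∞) x).contMDiffAt
      ((isOpen_extChartAt_target x).mem_nhds hs)).comp s hc.contMDiff.contMDiffAt
  have hd := hasDerivAt_extChartAt_comp (hs.self_of_nhds.mdifferentiableAt (by simp))
  have hd' : HasDerivAt c u 0 := by
    simpa [c] using ((hasDerivAt_id (0 : ℝ)).smul_const u).const_add
      (extChartAt 𝓘(ℝ, V) x x)
  have h1 : (mfderiv 𝓘(ℝ, ℝ) 𝓘(ℝ, V) γ 0 (1 : ℝ) : V) = u := by
    refine hd.unique (hd'.congr_of_eventuallyEq ?_)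
    filter_upwards [hev] with s hs
    rw [hγ0]
    exact (extChartAt 𝓘(ℝ, V) x).right_inv hs
  exact ⟨γ, hs, Bundle.TotalSpace.ext hγ0 (heq_of_eq h1)⟩

/-- The image of a tangent vector under a smooth map with values in `S` is tangent to `S`. -/
lemma mfderiv_mem_tangentSet {M : Type*} [TopologicalSpace M] [ChartedSpace V M]
    [IsManifold 𝓘(ℝ, V) ∞ M] {G : M → M'} (hG : ContMDiff 𝓘(ℝ, V) I' ∞ G) {S : Set M'}
    (hS : ∀ x, G x ∈ S) (x : M) (u : TangentSpace 𝓘(ℝ, V) x) :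
    mfderiv 𝓘(ℝ, V) I' G x u ∈ tangentSet I' S (G x) := by
  obtain ⟨γ, hγ, h0⟩ := exists_curve (V := V) x u
  obtain rfl : γ 0 = x := congrArg Bundle.TotalSpace.proj h0
  obtain rfl := eq_of_heq (Bundle.TotalSpace.mk.inj h0).2
  refine ⟨G ∘ γ, hγ.mono fun s hs => ⟨hG.contMDiffAt.comp s hs, hS _⟩, ?_⟩
  rw [mfderiv_comp (I' := 𝓘(ℝ, V)) 0 (hG.contMDiffAt.mdifferentiableAt (by simp))
    (hγ.self_of_nhds.mdifferentiableAt (by simp))]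
  rfl

variable {N : Type*} [TopologicalSpace N] [ChartedSpace H' N] {f : M → M'}

lemma mfderiv_graph_apply {x : M} (hf : MDifferentiableAt I I' f x) (u : TangentSpace I x) :
    mfderiv I (I.prod I') (fun y => (y, f y)) x u = ((u, mfderiv I I' f x u) : V × V') := by
  have h := ((hasMFDerivAt_id (I := I) x).prodMk hf.hasMFDerivAt).mfderiv
  exact DFunLike.congr_fun h u

/-- Along a curve in the graph the second component is `f` of the first near time `0`; the chain
rule does the rest. -/
lemma snd_eq_of_mem_tangentSet_graph {w : M × M'} (hf : MDifferentiableAt I I' f w.1)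
    {v : V × V'} (hv : v ∈ tangentSet (I.prod I') {w : M × M' | w.2 = f w.1} w) :
    v.2 = mfderiv I I' f w.1 v.1 := by
  obtain ⟨γ, hγ, h0⟩ := hv
  obtain rfl : γ 0 = w := congrArg Bundle.TotalSpace.proj h0
  have hv : (mfderiv 𝓘(ℝ, ℝ) (I.prod I') γ 0 (1 : ℝ) : V × V') = v :=
    eq_of_heq (Bundle.TotalSpace.mk.inj h0).2
  have hd := hγ.self_of_nhds.1.mdifferentiableAt (by simp)
  have h1 := (hasMFDerivAt_fst (I := I) (I' := I') (γ 0)).comp 0 hd.hasMFDerivAt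
  have h2 := ((hasMFDerivAt_snd (I := I) (I' := I') (γ 0)).comp 0 hd.hasMFDerivAt).mfderiv
  have h3 := (hf.hasMFDerivAt.comp 0 h1).mfderiv
  have h4 : mfderiv 𝓘(ℝ, ℝ) I' (Prod.snd ∘ γ) 0 = mfderiv 𝓘(ℝ, ℝ) I' (f ∘ Prod.fst ∘ γ) 0 :=
    Filter.EventuallyEq.mfderiv_eq (hγ.mono fun s hs => hs.2)
  rw [← hv]
  exact DFunLike.congr_fun (h2.symm.trans (h4.trans h3)) (1 : ℝ)

end TangentSets

/-! ### The tangent spaces of `W_1` -/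

section LegendreTangent

variable {n k : ℕ} {E : Type*} [TopologicalSpace E]
  [ChartedSpace (EuclideanSpace ℝ (Fin (n + 1))) E] {π : E → ℝ} [IsFibredOverLine n π]
  {hk : 1 ≤ k} {L : Jet n π k → ℝ}

lemma mdifferentiableAt_extendedLegendre
    (hF : ContMDiff 𝓘(ℝ, JetCoord n (2 * k - 1)) (cotangentModel n (k - 1)) ∞
      (extendedLegendre hk L)) (y : Jet n π (2 * k - 1)) :
    MDifferentiableAt 𝓘(ℝ, JetCoord n (2 * k - 1)) (cotangentModel n (k - 1))
      (extendedLegendre hk L) y :=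
  hF.contMDiffAt.mdifferentiableAt (by simp)

lemma mem_tangentSet_legendreGraph
    (hF : ContMDiff 𝓘(ℝ, JetCoord n (2 * k - 1)) (cotangentModel n (k - 1)) ∞
      (extendedLegendre hk L)) (y : Jet n π (2 * k - 1))
    (u : TangentSpace 𝓘(ℝ, JetCoord n (2 * k - 1)) y) :
    ((u, mfderiv 𝓘(ℝ, JetCoord n (2 * k - 1)) (cotangentModel n (k - 1))
      (extendedLegendre hk L) y u) :
        TangentSpace (jetMomentumModel n k) (y, extendedLegendre hk L y)) ∈
      tangentSet (jetMomentumModel n k) (legendreGraph hk L) (y, extendedLegendre hk L y) := by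
  have h := mfderiv_mem_tangentSet (I' := jetMomentumModel n k)
    (G := fun y => (y, extendedLegendre hk L y)) (contMDiff_id.prodMk hF)
    (S := legendreGraph hk L) (fun _ => rfl) y u
  rw [mfderiv_graph_apply (mdifferentiableAt_extendedLegendre hF y)] at h
  exact h

lemma snd_eq_of_mem_tangentSet_legendreGraph
    (hF : ContMDiff 𝓘(ℝ, JetCoord n (2 * k - 1)) (cotangentModel n (k - 1)) ∞
      (extendedLegendre hk L)) {y : Jet n π (2 * k - 1)}
    {v : TangentSpace (jetMomentumModel n k) (y, extendedLegendre hk L y)}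
    (hv : v ∈ tangentSet (jetMomentumModel n k) (legendreGraph hk L)
      (y, extendedLegendre hk L y)) :
    v.2 = mfderiv 𝓘(ℝ, JetCoord n (2 * k - 1)) (cotangentModel n (k - 1))
      (extendedLegendre hk L) y v.1 := by
  exact snd_eq_of_mem_tangentSet_graph (mdifferentiableAt_extendedLegendre hF y) hv

end LegendreTangent

/-! ### The tangent spaces of `W_o` along `W_1` -/

section HamiltonianTangent

variable {n k : ℕ} {E : Type*} [TopologicalSpace E]
  [ChartedSpace (EuclideanSpace ℝ (Fin (n + 1))) E] {π : E → ℝ} [IsFibredOverLine n π]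

lemma trivializationAt_cotangent_self (α : CotangentJet n π k) :
    (trivializationAt (JetCoord n k →L[ℝ] ℝ) (CotangentFiber n π k) α.1 α).2 = α.2 := by
  rw [trivializationAt_cotangent α.1 α (mem_chart_source _ α.1)]
  refine ContinuousLinearMap.ext fun v => ?_
  have h := tangentCoordChange_self (I := 𝓘(ℝ, JetCoord n k)) (v := (v : JetCoord n k))
    (mem_extChartAt_source (I := 𝓘(ℝ, JetCoord n k)) α.1)
  exact congrArg (fun z : JetCoord n k => (α.2 : JetCoord n k →L[ℝ] ℝ) z) h

lemma mem_baseSet_cotangent {x₀ x : Jet n π k} (h : x ∈ (chartAt (JetCoord n k) x₀).source) :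
    x ∈ (trivializationAt (JetCoord n k →L[ℝ] ℝ) (CotangentFiber n π k) x₀).baseSet := by
  rw [hom_trivializationAt_baseSet]
  exact ⟨h, trivial⟩

/-- The linear part of `shift`. -/
def shiftLinear {r N : ℕ} (h : r + 1 ≤ N) (x : JetCoord n N) : JetCoord n r :=
  (0, fun i => x.2 ⟨i + 1, by omega⟩)

lemma HasDerivAt.fst_comp {V V' : Type*} [NormedAddCommGroup V] [NormedSpace ℝ V]
    [NormedAddCommGroup V'] [NormedSpace ℝ V'] {f : ℝ → V × V'} {v : V × V'} {t : ℝ}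
    (h : HasDerivAt f v t) : HasDerivAt (fun s => (f s).1) v.1 t :=
  (ContinuousLinearMap.fst ℝ V V').hasFDerivAt.comp_hasDerivAt t h

lemma HasDerivAt.snd_comp {V V' : Type*} [NormedAddCommGroup V] [NormedSpace ℝ V]
    [NormedAddCommGroup V'] [NormedSpace ℝ V'] {f : ℝ → V × V'} {v : V × V'} {t : ℝ}
    (h : HasDerivAt f v t) : HasDerivAt (fun s => (f s).2) v.2 t :=
  (ContinuousLinearMap.snd ℝ V V').hasFDerivAt.comp_hasDerivAt t h

lemma HasDerivAt.shift {r N : ℕ} (h : r + 1 ≤ N) {X : ℝ → JetCoord n N} {v : JetCoord n N} {t : ℝ}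
    (hX : HasDerivAt X v t) : HasDerivAt (fun s => shift h (X s)) (shiftLinear h v) t := by
  exact (hasDerivAt_const t (1 : ℝ)).prodMk 
    (hasDerivAt_pi.2 fun i => hasDerivAt_pi.1 (HasDerivAt.snd_comp hX) _)

lemma HasDerivAt.truncate {r N : ℕ} (h : r ≤ N) {X : ℝ → JetCoord n N} {v : JetCoord n N} {t : ℝ}
    (hX : HasDerivAt X v t) : HasDerivAt (fun s => truncate h (X s)) (truncate h v) t := by
  exact (HasDerivAt.fst_comp hX).prodMk
    (hasDerivAt_pi.2 fun i => hasDerivAt_pi.1 (HasDerivAt.snd_comp hX) _)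

/-- The coordinate expression of a Lagrangian around a point of `E`. -/
def localLagrangian (L : Jet n π k → ℝ) (x : E) (z : JetCoord n k) : ℝ :=
  L ((jetChart k (isAdaptedChart_adaptedChartAt π x)).symm z)

lemma differentiableAt_localLagrangian {L : Jet n π k → ℝ}
    (hL : ContMDiff 𝓘(ℝ, JetCoord n k) 𝓘(ℝ, ℝ) ∞ L) (y : Jet n π k) :
    DifferentiableAt ℝ (localLagrangian L y.point) (y.coord (adaptedChartAt π y.point)) := by
  have h1 : ContMDiffAt 𝓘(ℝ, JetCoord n k) 𝓘(ℝ, ℝ) ∞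
      (L ∘ (extChartAt 𝓘(ℝ, JetCoord n k) y).symm) (y.coord (adaptedChartAt π y.point)) :=
    hL.contMDiffAt.comp _ ((contMDiffOn_extChartAt_symm (n := ∞) y).contMDiffAt
      (extChartAt_target_mem_nhds (I := 𝓘(ℝ, JetCoord n k)) y))
  exact h1.contDiffAt.differentiableAt (by simp)

variable {hk : 1 ≤ k} {L : Jet n π k → ℝ}

/-- The equations of the tangent space of `W_o` in coordinates. -/
lemma coord_of_mem_tangentSet (hL : ContMDiff 𝓘(ℝ, JetCoord n k) 𝓘(ℝ, ℝ) ∞ L)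
    {w : JetMomentum n π k}
    {v : JetCoord n (2 * k - 1) × (JetCoord n (k - 1) × (JetCoord n (k - 1) →L[ℝ] ℝ))}
    (hv : v ∈ tangentSet (jetMomentumModel n k) (hamiltonianSubmanifold hk L) w) :
    v.2.1 = truncate (by omega) v.1 ∧
      v.2.2 (shift (by omega) (w.1.coord (adaptedChartAt π w.2.1.point))) +
        (w.2.2 : JetCoord n (k - 1) →L[ℝ] ℝ) (shiftLinear (by omega) v.1) =
      fderiv ℝ (localLagrangian L w.2.1.point)
        (truncate (by omega) (w.1.coord (adaptedChartAt π w.2.1.point)))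
        (truncate (by omega) v.1) := by
  obtain ⟨γ, hγ, h0⟩ := hv
  obtain rfl : γ 0 = w := congrArg Bundle.TotalSpace.proj h0
  have hv : (mfderiv 𝓘(ℝ, ℝ) (jetMomentumModel n k) γ 0 (1 : ℝ) :
      JetCoord n (2 * k - 1) × (JetCoord n (k - 1) × (JetCoord n (k - 1) →L[ℝ] ℝ))) = v :=
    eq_of_heq (Bundle.TotalSpace.mk.inj h0).2
  have hW : ∀ᶠ s in 𝓝 (0 : ℝ), (γ s).1.proj (by omega : k - 1 ≤ 2 * k - 1) = (γ s).2.1 :=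
    hγ.mono fun s hs => hs.2.1
  have hC : ∀ᶠ s in 𝓝 (0 : ℝ), coupling (γ s) = L ((γ s).1.proj (by omega)) :=
    hγ.mono fun s hs => hs.2.2
  have hq : (γ 0).1.point = (γ 0).2.1.point := by
    rw [← hW.self_of_nhds, Jet.point_proj]
  have hd := hγ.self_of_nhds.1.mdifferentiableAt (by simp)
  -- The components of `v` are the derivatives of the coordinates of `γ` in the one chart at `γ 0`;
  -- they are next separated into jet, base point and covector.
  have dγ := hasDerivAt_extChartAt_comp hd
  rw [hv, extChartAt_prod] at dγ
  have dX : HasDerivAt (fun s => (γ s).1.coord (adaptedChartAt π (γ 0).2.1.point)) v.1 0 := by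
    rw [← hq]
    exact HasDerivAt.fst_comp dγ
  have dB : HasDerivAt (fun s => extChartAt (cotangentModel n (k - 1)) (γ 0).2 (γ s).2) v.2 0 :=
    HasDerivAt.snd_comp dγ
  have hs : ∀ᶠ s in 𝓝 (0 : ℝ), (γ s).1.point ∈
      (adaptedChartAt (n := n) π (γ 0).2.1.point).source := by
    rw [← hq]
    exact (hγ.self_of_nhds.1.continuousAt.fst).eventually (Jet.eventually_point_mem (γ 0).1)
  have hs' : ∀ᶠ s in 𝓝 (0 : ℝ), (γ s).2.1 ∈ (chartAt (JetCoord n (k - 1)) (γ 0).2.1).source := by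
    filter_upwards [hs, hW] with s hs hW
    rw [← extChartAt_source 𝓘(ℝ, JetCoord n (k - 1)), Jet.mem_extChartAt_source, ← hW]
    rwa [Jet.point_proj (by omega : k - 1 ≤ 2 * k - 1) (γ s).1]
  have he := isAdaptedChart_adaptedChartAt (n := n) π (γ 0).2.1.point
  have dB1 : HasDerivAt (fun s => (γ s).2.1.coord (adaptedChartAt π (γ 0).2.1.point)) v.2.1 0 := by
    refine (HasDerivAt.fst_comp dB).congr_of_eventuallyEq ?_
    filter_upwards [hs'] with s hs'
    exact (congrArg Prod.fst
      (extChartAt_totalSpace_apply (V := JetCoord n (k - 1)) (γ 0).2 (γ s).2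
        (mem_baseSet_cotangent hs'))).symm
  have dB2 : HasDerivAt (fun s => (trivializationAt (JetCoord n (k - 1) →L[ℝ] ℝ)
      (CotangentFiber n π (k - 1)) (γ 0).2.1 (γ s).2).2) v.2.2 0 := by
    refine (HasDerivAt.snd_comp dB).congr_of_eventuallyEq ?_
    filter_upwards [hs'] with s hs'
    exact (congrArg Prod.snd
      (extChartAt_totalSpace_apply (V := JetCoord n (k - 1)) (γ 0).2 (γ s).2
        (mem_baseSet_cotangent hs'))).symm
  -- First equation: derivative of the fibre product condition, whose coordinate form is truncation.
  refine ⟨dB1.unique ((HasDerivAt.truncate _ dX).congr_of_eventuallyEq ?_), ?_⟩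
  · filter_upwards [hs, hW] with s hs hW
    rw [← hW]
    exact Jet.coord_proj _ he _ hs
  -- Second equation: `Ĉ` is a covector evaluated on a vector, both varying, so the product rule
  -- gives the left-hand side; differentiating `L` gives the right-hand side.
  have d1 := dB2.clm_apply (HasDerivAt.shift (r := k - 1) (by omega) dX)
  rw [trivializationAt_cotangent_self] at d1
  have hdL : DifferentiableAt ℝ (localLagrangian L (γ 0).2.1.point)
      (truncate (by omega) ((γ 0).1.coord (adaptedChartAt π (γ 0).2.1.point))) := by
    have h1 := differentiableAt_localLagrangian hL
      ((γ 0).1.proj (by omega : k ≤ 2 * k - 1))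
    rw [Jet.point_proj, hq] at h1
    rwa [Jet.coord_proj _ he _ hs.self_of_nhds] at h1
  have d2 := hdL.hasFDerivAt.comp_hasDerivAt (0 : ℝ)
    (HasDerivAt.truncate (by omega : k ≤ 2 * k - 1) dX)
  refine d1.unique (d2.congr_of_eventuallyEq ?_)
  filter_upwards [hs, hγ] with s hs hγ
  have h1 := coupling_eq_trivializationAt hk (γ s) hγ.2.1 (γ 0).2.1 hs
  rw [← h1, hγ.2.2]
  exact congrArg L (jetChart_symm_truncate (by omega) he (γ s).1 hs).symm

/-- A vector tangent to `W_o` at a point of `W_1` with the momenta of a vector tangent to `W_1`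
has the same component in `T*(J^{k-1} π)`. -/
lemma snd_eq_of_mfderiv_quotientMap_eq (hL : ContMDiff 𝓘(ℝ, JetCoord n k) 𝓘(ℝ, ℝ) ∞ L)
    {y : Jet n π (2 * k - 1)}
    {v u : JetCoord n (2 * k - 1) × (JetCoord n (k - 1) × (JetCoord n (k - 1) →L[ℝ] ℝ))}
    (hv : v ∈ tangentSet (jetMomentumModel n k) (hamiltonianSubmanifold hk L)
      (y, extendedLegendre hk L y))
    (hu : u ∈ tangentSet (jetMomentumModel n k) (hamiltonianSubmanifold hk L)
      (y, extendedLegendre hk L y))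
    (h1 : v.2.1 = u.2.1)
    (h2 : v.2.2.comp (ContinuousLinearMap.inr ℝ ℝ (Fin (k - 1 + 1) → Fin n → ℝ)) =
      u.2.2.comp (ContinuousLinearMap.inr ℝ ℝ (Fin (k - 1 + 1) → Fin n → ℝ))) :
    v.2 = u.2 := by
  obtain ⟨a1, a2⟩ := coord_of_mem_tangentSet hL hv
  obtain ⟨b1, b2⟩ := coord_of_mem_tangentSet hL hu
  -- Equal images under `Tμ` leave only a difference `c dt` in the momenta; the aim is `c = 0`.
  obtain ⟨c, hc⟩ := (comp_inr_eq_iff _ _).1 h2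
  set x : JetCoord n (2 * k - 1) :=
    y.coord (adaptedChartAt π (y.proj (by omega : k - 1 ≤ 2 * k - 1)).point)
  set ℓ := localLagrangian L (y.proj (by omega : k - 1 ≤ 2 * k - 1)).point
  have key := legendreCovector_single_last hk ℓ x (v.1.2 ⟨k, by omega⟩ - u.1.2 ⟨k, by omega⟩)
  -- The components along the `(k-1)`-jets agree, so on `k`-jets `v` and `u` differ only in `δq_k`.
  have ht : (truncate (by omega) v.1 : JetCoord n (k - 1)) = truncate (by omega) u.1 := by
    rw [← a1, ← b1, h1]
  have ht1 : v.1.1 = u.1.1 := congrArg (fun z : JetCoord n (k - 1) => z.1) ht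
  have ht2 : ∀ i : ℕ, ∀ hi : i < k, v.1.2 ⟨i, by omega⟩ = u.1.2 ⟨i, by omega⟩ := fun i hi =>
    congrFun (congrArg (fun z : JetCoord n (k - 1) => z.2) ht) ⟨i, by omega⟩
  have e1 : ((0, fun i => if (i : ℕ) = k then v.1.2 ⟨k, by omega⟩ - u.1.2 ⟨k, by omega⟩ else 0) :
      JetCoord n k) = truncate (by omega) v.1 - truncate (by omega) u.1 := by
    refine Prod.ext (by simp [truncate, ht1]) (funext fun i => ?_)
    change _ = v.1.2 (Fin.castLE _ i) - u.1.2 (Fin.castLE _ i)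
    dsimp only
    split_ifs with hi
    · obtain rfl : i = Fin.last k := Fin.ext hi
      rfl
    · exact (sub_eq_zero.2 (ht2 i (by omega))).symm
  -- The shift moves `δq_k` into slot `k - 1`, where it is paired with `p^{k-1}`.
  have e2 : ((0, fun i => if (i : ℕ) = k - 1 then
      v.1.2 ⟨k, by omega⟩ - u.1.2 ⟨k, by omega⟩ else 0) :
      JetCoord n (k - 1)) = shiftLinear (by omega) v.1 - shiftLinear (by omega) u.1 := by
    refine Prod.ext (by simp [shiftLinear]) (funext fun i => ?_)
    change _ = v.1.2 ⟨i + 1, by omega⟩ - u.1.2 ⟨i + 1, by omega⟩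
    dsimp only
    split_ifs with hi
    · have h3 : (⟨i + 1, by omega⟩ : Fin (2 * k - 1 + 1)) = ⟨k, by omega⟩ := Fin.ext (by
        change (i : ℕ) + 1 = k
        omega)
      rw [h3]
    · exact (sub_eq_zero.2 (ht2 (i + 1) (by omega))).symm
  rw [e1, e2, map_sub, map_sub] at key
  refine Prod.ext h1 ?_
  have e3 : v.2.2 (shift (by omega) x) = u.2.2 (shift (by omega) x) + c := by
    rw [hc]
    simp [shift]
  have a2' : v.2.2 (shift (by omega) x) + legendreCovector hk ℓ x (shiftLinear (by omega) v.1) =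
    fderiv ℝ ℓ (truncate (by omega) x) (truncate (by omega) v.1) := a2
  have b2' : u.2.2 (shift (by omega) x) + legendreCovector hk ℓ x (shiftLinear (by omega) u.1) =
    fderiv ℝ ℓ (truncate (by omega) x) (truncate (by omega) u.1) := b2
  -- Subtracting the two tangency equations leaves `c + p^{k-1} · δq_k = ∂L/∂q_k · δq_k`, and `key`
  -- cancels everything but `c`.
  have hc0 : c = 0 := by linarith
  rw [hc, hc0, zero_smul, add_zero]

end HamiltonianTangent

/-! ### Nondegeneracy, and both formalisms read through the Legendre tangent maps -/

section Equivalence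

/-- A vector without `dt` component in the kernel of the form induced by the canonical one on a
hyperplane transverse to the direction of `dt` is zero. -/
lemma eq_zero_of_forall_canonical_eq_zero {n r : ℕ} {V : Type*}
    {T : V → JetCoord n r × (JetCoord n r →L[ℝ] ℝ)}
    (hT : ∀ w : JetCoord n r × ((Fin (r + 1) → Fin n → ℝ) →L[ℝ] ℝ), ∃ u, (T u).1 = w.1 ∧
      (T u).2.comp (ContinuousLinearMap.inr ℝ ℝ (Fin (r + 1) → Fin n → ℝ)) = w.2)
    {U : JetCoord n r × (JetCoord n r →L[ℝ] ℝ)} (h0 : U.1.1 = 0)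
    (h : ∀ u, (T u).2 U.1 - U.2 (T u).1 = 0) : U = 0 := by
  -- Any `W` differs from some `T u` by a multiple of the fibre direction `dt`, and the pairing of
  -- `U` with that direction is a multiple of `dt(U) = 0`; so `U` is orthogonal to everything.
  have h1 : ∀ W : JetCoord n r × (JetCoord n r →L[ℝ] ℝ), W.2 U.1 - U.2 W.1 = 0 := by
    intro W
    obtain ⟨u, hu1, hu2⟩ := hT (W.1, W.2.comp (ContinuousLinearMap.inr ℝ ℝ _))
    obtain ⟨c, hc⟩ := (comp_inr_eq_iff _ _).1 hu2
    have h2 := h u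
    rw [hu1, hc] at h2
    simpa [h0] using h2
  refine Prod.ext ?_ (ContinuousLinearMap.ext fun z => ?_)
  · refine SeparatingDual.eq_zero_of_forall_dual_eq_zero (R := ℝ) fun f => ?_
    simpa using h1 (0, f)
  · simpa using h1 (z, 0)

/-- Vectors are kept in the model spaces, so the map and base point can be replaced by equal ones
without transport between tangent spaces. -/
lemma mfderiv_apply_congr {V : Type*} [NormedAddCommGroup V] [NormedSpace ℝ V] {H : Type*}
    [TopologicalSpace H] {I : ModelWithCorners ℝ V H} {M : Type*} [TopologicalSpace M]
    [ChartedSpace H M] {V' : Type*} [NormedAddCommGroup V'] [NormedSpace ℝ V'] {H' : Type*}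
    [TopologicalSpace H'] {I' : ModelWithCorners ℝ V' H'} {M' : Type*} [TopologicalSpace M']
    [ChartedSpace H' M'] {f g : M → M'} (hfg : f = g) {x y : M} (hxy : x = y) (u : V) :
    (mfderiv I I' f x u : V') = mfderiv I I' g y u := by
  subst hfg
  subst hxy
  rfl

variable {n k : ℕ} {E : Type*} [TopologicalSpace E]
  [ChartedSpace (EuclideanSpace ℝ (Fin (n + 1))) E] {π : E → ℝ} [IsFibredOverLine n π]
  {hk : 1 ≤ k} {L : Jet n π k → ℝ}

variable (hk L) in
/-- The tangent map of the extended Legendre–Ostrogradsky map in the induced coordinates. -/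
def legendreTangent (y : Jet n π (2 * k - 1)) :
    JetCoord n (2 * k - 1) →L[ℝ] JetCoord n (k - 1) × (JetCoord n (k - 1) →L[ℝ] ℝ) :=
  mfderiv 𝓘(ℝ, JetCoord n (2 * k - 1)) (cotangentModel n (k - 1)) (extendedLegendre hk L) y

variable (hk L) in
/-- The tangent map of the restricted Legendre–Ostrogradsky map in the induced coordinates. -/
def restrictedTangent (y : Jet n π (2 * k - 1)) : JetCoord n (2 * k - 1) →L[ℝ]
    JetCoord n (k - 1) × ((Fin (k - 1 + 1) → Fin n → ℝ) →L[ℝ] ℝ) :=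
  mfderiv 𝓘(ℝ, JetCoord n (2 * k - 1)) (restrictedModel n (k - 1)) (restrictedLegendre hk L) y

lemma restrictedTangent_apply
    (hF : ContMDiff 𝓘(ℝ, JetCoord n (2 * k - 1)) (cotangentModel n (k - 1)) ∞
      (extendedLegendre hk L)) (y : Jet n π (2 * k - 1)) (u : JetCoord n (2 * k - 1)) :
    restrictedTangent hk L y u = ((legendreTangent hk L y u).1,
      (legendreTangent hk L y u).2.comp
        (ContinuousLinearMap.inr ℝ ℝ (Fin (k - 1 + 1) → Fin n → ℝ))) := by
  have h1 := mfderiv_comp y (contMDiff_quotientMap.contMDiffAt.mdifferentiableAt (by simp))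
    (mdifferentiableAt_extendedLegendre hF y)
  rw [mfderiv_quotientMap] at h1
  exact DFunLike.congr_fun h1 u

lemma mfderiv_toRestricted (w : JetMomentum n π k)
    (v : JetCoord n (2 * k - 1) × (JetCoord n (k - 1) × (JetCoord n (k - 1) →L[ℝ] ℝ))) :
    mfderiv (jetMomentumModel n k) (restrictedModel n (k - 1))
      (toRestricted : JetMomentum n π k → RestrictedJet n π (k - 1)) w v =
      (v.2.1, v.2.2.comp (ContinuousLinearMap.inr ℝ ℝ (Fin (k - 1 + 1) → Fin n → ℝ))) := by
  have h1 := mfderiv_comp w (g := (quotientMap : CotangentJet n π (k - 1) → _))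
    (contMDiff_quotientMap.contMDiffAt.mdifferentiableAt (by simp))
    (mdifferentiableAt_snd (I := 𝓘(ℝ, JetCoord n (2 * k - 1))) (I' := cotangentModel n (k - 1)))
  rw [mfderiv_quotientMap, mfderiv_snd] at h1
  exact DFunLike.congr_fun h1 v

lemma unifiedForm_apply (w : JetMomentum n π k)
    (u v : JetCoord n (2 * k - 1) × (JetCoord n (k - 1) × (JetCoord n (k - 1) →L[ℝ] ℝ))) :
    unifiedForm w u v = v.2.2 u.2.1 - u.2.2 v.2.1 := by
  have h1 : ∀ u : JetCoord n (2 * k - 1) × (JetCoord n (k - 1) × (JetCoord n (k - 1) →L[ℝ] ℝ)),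
      (mfderiv (jetMomentumModel n k) (cotangentModel n (k - 1))
        (Prod.snd : JetMomentum n π k → CotangentJet n π (k - 1)) w u :
          JetCoord n (k - 1) × (JetCoord n (k - 1) →L[ℝ] ℝ)) = u.2 := fun u =>
    DFunLike.congr_fun mfderiv_snd u
  refine (canonicalForm_apply w.2 _ _).trans ?_
  rw [h1, h1]

lemma mfderiv_time_jetMomentum (w : JetMomentum n π k)
    (v : JetCoord n (2 * k - 1) × (JetCoord n (k - 1) × (JetCoord n (k - 1) →L[ℝ] ℝ))) :
    (mfderiv (jetMomentumModel n k) 𝓘(ℝ, ℝ) (fun w : JetMomentum n π k => w.1.time) w v : ℝ) =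
      v.1.1 := by
  have h1 := mfderiv_comp w (g := (Jet.time : Jet n π (2 * k - 1) → ℝ))
    (Jet.contMDiff_time.contMDiffAt.mdifferentiableAt (by simp))
    (mdifferentiableAt_fst (I := 𝓘(ℝ, JetCoord n (2 * k - 1))) (I' := cotangentModel n (k - 1)))
  rw [mfderiv_fst] at h1
  refine (DFunLike.congr_fun h1 v).trans ?_
  exact DFunLike.congr_fun (Jet.dt_eq w.1) v.1

lemma mfderiv_time_restrictedJet (a : RestrictedJet n π k)
    (v : JetCoord n k × ((Fin (k + 1) → Fin n → ℝ) →L[ℝ] ℝ)) :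
    (mfderiv (restrictedModel n k) 𝓘(ℝ, ℝ) (fun a : RestrictedJet n π k => a.proj.time) a v : ℝ) =
      v.1.1 := by
  have h1 := mfderiv_comp a (g := (Jet.time : Jet n π k → ℝ))
    (f := (Bundle.TotalSpace.proj : RestrictedJet n π k → Jet n π k))
    (Jet.contMDiff_time.contMDiffAt.mdifferentiableAt (by simp))
    ((Bundle.contMDiffAt_proj (IB := 𝓘(ℝ, JetCoord n k)) (n := ∞) _).mdifferentiableAt (by simp))
  rw [mfderiv_totalSpace_proj] at h1
  refine (DFunLike.congr_fun h1 v).trans ?_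
  exact DFunLike.congr_fun (Jet.dt_eq a.1) v.1

lemma graph_mem_tangentSet
    (hF : ContMDiff 𝓘(ℝ, JetCoord n (2 * k - 1)) (cotangentModel n (k - 1)) ∞
      (extendedLegendre hk L)) (y : Jet n π (2 * k - 1)) (u : JetCoord n (2 * k - 1)) :
    (u, legendreTangent hk L y u) ∈ tangentSet (jetMomentumModel n k)
      (hamiltonianSubmanifold hk L) (y, extendedLegendre hk L y) :=
  tangentSet_mono (legendreGraph_subset hk L) _ (mem_tangentSet_legendreGraph hF y u)

/-- The Legendre map covers the projection to `J^{k-1} π`, which preserves `t`. -/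
lemma legendreTangent_time (hL : ContMDiff 𝓘(ℝ, JetCoord n k) 𝓘(ℝ, ℝ) ∞ L)
    (hF : ContMDiff 𝓘(ℝ, JetCoord n (2 * k - 1)) (cotangentModel n (k - 1)) ∞
      (extendedLegendre hk L)) (y : Jet n π (2 * k - 1)) (u : JetCoord n (2 * k - 1)) :
    (legendreTangent hk L y u).1.1 = u.1 := by
  have h := (coord_of_mem_tangentSet hL (graph_mem_tangentSet hF y u)).1
  exact congrArg (fun z : JetCoord n (k - 1) => z.1) h

variable {Φ : Diffeomorph 𝓘(ℝ, JetCoord n (2 * k - 1)) (restrictedModel n (k - 1))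
  (Jet n π (2 * k - 1)) (RestrictedJet n π (k - 1)) ∞}

lemma bijective_restrictedTangent (hΦ : ⇑Φ = restrictedLegendre hk L) (y : Jet n π (2 * k - 1)) :
    Function.Bijective (restrictedTangent hk L y) := by
  have h1 := (Φ.mfderivToContinuousLinearEquiv (by simp) y).bijective
  have h2 : ⇑(Φ.mfderivToContinuousLinearEquiv (by simp) y) = restrictedTangent hk L y :=
    funext fun u => mfderiv_apply_congr (V := JetCoord n (2 * k - 1))
      (V' := JetCoord n (k - 1) × ((Fin (k - 1 + 1) → Fin n → ℝ) →L[ℝ] ℝ)) hΦ rfl u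
  rwa [h2] at h1

/-- From `h ∘ FL = FL~` one gets `Th ∘ T FL = T FL~`, so `FL^* Ω_h = FL~^* Ω`. This is where the two
formalisms meet. -/
lemma hamiltonCartanForm_apply (hΦ : ⇑Φ = restrictedLegendre hk L)
    (hF : ContMDiff 𝓘(ℝ, JetCoord n (2 * k - 1)) (cotangentModel n (k - 1)) ∞
      (extendedLegendre hk L)) (y : Jet n π (2 * k - 1)) (u v : JetCoord n (2 * k - 1)) :
    hamiltonCartanForm hk L (restrictedLegendre hk L y) (restrictedTangent hk L y u)
      (restrictedTangent hk L y v) =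
      (legendreTangent hk L y v).2 (legendreTangent hk L y u).1 -
        (legendreTangent hk L y u).2 (legendreTangent hk L y v).1 := by
  have hinj : Function.Injective (restrictedLegendre hk L) := hΦ ▸ Φ.injective
  have hfun : hamiltonianSection hk L = extendedLegendre hk L ∘ Φ.symm := by
    funext a
    obtain ⟨y, hy⟩ := Φ.surjective a
    obtain rfl : Φ y = a := hy
    rw [hΦ, hamiltonianSection_restrictedLegendre hk L hinj, ← hΦ]
    simp
  -- The section `h` is smooth because it equals `FL~ ∘ FL⁻¹`; this justifies the chain rule in
  -- `h1`.
  have hsm : ContMDiff (restrictedModel n (k - 1)) (cotangentModel n (k - 1)) ∞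
      (hamiltonianSection hk L) := hfun ▸ hF.comp Φ.symm.contMDiff
  have hFL : ContMDiff 𝓘(ℝ, JetCoord n (2 * k - 1)) (restrictedModel n (k - 1)) ∞
      (restrictedLegendre hk L) := hΦ ▸ Φ.contMDiff
  have h1 : ∀ u : JetCoord n (2 * k - 1), (mfderiv (restrictedModel n (k - 1))
      (cotangentModel n (k - 1)) (hamiltonianSection hk L) (restrictedLegendre hk L y)
        (restrictedTangent hk L y u) : JetCoord n (k - 1) × (JetCoord n (k - 1) →L[ℝ] ℝ)) =
        legendreTangent hk L y u := by
    intro u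
    have h2 := mfderiv_comp y (hsm.contMDiffAt.mdifferentiableAt (by simp))
      (hFL.contMDiffAt.mdifferentiableAt (by simp) (x := y))
    refine (DFunLike.congr_fun h2 u).symm.trans (mfderiv_apply_congr
      (V := JetCoord n (2 * k - 1)) (V' := JetCoord n (k - 1) × (JetCoord n (k - 1) →L[ℝ] ℝ))
      ?_ rfl u)
    exact funext (hamiltonianSection_restrictedLegendre hk L hinj)
  refine (canonicalForm_apply (hamiltonianSection hk L (restrictedLegendre hk L y)) _ _).trans ?_
  rw [h1, h1]

end Equivalence

/-! ### Transport of vector fields between `W_1`, `J^{2k-1} π` and `J^{k-1} π^*` -/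

section VectorFields

variable {n k : ℕ} {E : Type*} [TopologicalSpace E]
  [ChartedSpace (EuclideanSpace ℝ (Fin (n + 1))) E] {π : E → ℝ} [IsFibredOverLine n π]
  {hk : 1 ≤ k} {L : Jet n π k → ℝ}
  {Φ : Diffeomorph 𝓘(ℝ, JetCoord n (2 * k - 1)) (restrictedModel n (k - 1))
    (Jet n π (2 * k - 1)) (RestrictedJet n π (k - 1)) ∞}

/-- The smoothness of a vector field on `J^N π`. -/
def IsSmoothField {N : ℕ} (v : Jet n π N → JetCoord n N) : Prop :=
  ContMDiff 𝓘(ℝ, JetCoord n N) 𝓘(ℝ, JetCoord n N).tangent ∞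
    (fun y => (⟨y, v y⟩ : TangentBundle 𝓘(ℝ, JetCoord n N) (Jet n π N)))

/-- The push-forward of a vector field by the restricted Legendre–Ostrogradsky map. -/
def pushField (hk : 1 ≤ k) (L : Jet n π k → ℝ)
    (Φ : Diffeomorph 𝓘(ℝ, JetCoord n (2 * k - 1)) (restrictedModel n (k - 1))
      (Jet n π (2 * k - 1)) (RestrictedJet n π (k - 1)) ∞)
    (v : Jet n π (2 * k - 1) → JetCoord n (2 * k - 1)) (a : RestrictedJet n π (k - 1)) :
    JetCoord n (k - 1) × ((Fin (k - 1 + 1) → Fin n → ℝ) →L[ℝ] ℝ) :=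
  restrictedTangent hk L (Φ.symm a) (v (Φ.symm a))

lemma pushField_apply (hΦ : ⇑Φ = restrictedLegendre hk L)
    (v : Jet n π (2 * k - 1) → JetCoord n (2 * k - 1)) (y : Jet n π (2 * k - 1)) :
    pushField hk L Φ v (restrictedLegendre hk L y) = restrictedTangent hk L y (v y) := by
  rw [pushField, ← hΦ, Φ.symm_apply_apply]

lemma contMDiff_pushField (hΦ : ⇑Φ = restrictedLegendre hk L)
    {v : Jet n π (2 * k - 1) → JetCoord n (2 * k - 1)} (hv : IsSmoothField v) :
    ContMDiff (restrictedModel n (k - 1)) (restrictedModel n (k - 1)).tangent ∞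
      (fun a => (⟨a, pushField hk L Φ v a⟩ :
        TangentBundle (restrictedModel n (k - 1)) (RestrictedJet n π (k - 1)))) := by
  have hFL : ContMDiff 𝓘(ℝ, JetCoord n (2 * k - 1)) (restrictedModel n (k - 1)) ∞
      (restrictedLegendre hk L) := hΦ ▸ Φ.contMDiff
  have h := ((hFL.contMDiff_tangentMap (m := ∞) (by simp)).comp hv).comp Φ.symm.contMDiff
  refine h.congr fun a => ?_
  refine Bundle.TotalSpace.ext ?_ (heq_of_eq rfl)
  change a = restrictedLegendre hk L (Φ.symm a)
  rw [← hΦ, Φ.apply_symm_apply]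

lemma exists_eq_restrictedLegendre (hΦ : ⇑Φ = restrictedLegendre hk L)
    (a : RestrictedJet n π (k - 1)) : ∃ y, restrictedLegendre hk L y = a := by
  rw [← hΦ]
  exact Φ.surjective a

/-- A vector field on `J^{2k-1} π` whose image under the extended Legendre–Ostrogradsky map
annihilates the canonical form pushes forward to a Hamiltonian solution. -/
lemma isHamiltonianSolution_pushField (hL : ContMDiff 𝓘(ℝ, JetCoord n k) 𝓘(ℝ, ℝ) ∞ L)
    (hΦ : ⇑Φ = restrictedLegendre hk L)
    (hF : ContMDiff 𝓘(ℝ, JetCoord n (2 * k - 1)) (cotangentModel n (k - 1)) ∞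
      (extendedLegendre hk L))
    {v : Jet n π (2 * k - 1) → JetCoord n (2 * k - 1)} (hv : IsSmoothField v)
    (h0 : ∀ y, (v y).1 = 1)
    (h1 : ∀ y u, (legendreTangent hk L y u).2 (legendreTangent hk L y (v y)).1 -
      (legendreTangent hk L y (v y)).2 (legendreTangent hk L y u).1 = 0) :
    IsHamiltonianSolution hk L (pushField hk L Φ v) := by
  refine ⟨contMDiff_pushField hΦ hv, fun a u => ?_, fun a => ?_⟩
  · obtain ⟨y, rfl⟩ := exists_eq_restrictedLegendre hΦ a
    -- Surjectivity of `T FL` makes the hypothesis on images of `T FL~` cover every test vector.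
    obtain ⟨u, rfl⟩ := (bijective_restrictedTangent hΦ y).2 u
    rw [pushField_apply hΦ, hamiltonCartanForm_apply hΦ hF]
    exact h1 y u
  · obtain ⟨y, rfl⟩ := exists_eq_restrictedLegendre hΦ a
    rw [pushField_apply hΦ]
    refine (mfderiv_time_restrictedJet _ _).trans ?_
    rw [restrictedTangent_apply hF, legendreTangent_time hL hF]
    exact h0 y

/-- The Hamiltonian equations have at most one solution. -/
lemma eq_of_hamiltonian (hΦ : ⇑Φ = restrictedLegendre hk L)
    (hF : ContMDiff 𝓘(ℝ, JetCoord n (2 * k - 1)) (cotangentModel n (k - 1)) ∞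
      (extendedLegendre hk L)) {X Z} (hX : IsHamiltonianSolution hk L X)
    (hZ : IsHamiltonianSolution hk L Z) : Z = X := by
  funext a
  obtain ⟨y, rfl⟩ := exists_eq_restrictedLegendre hΦ a
  obtain ⟨x, hx⟩ := (bijective_restrictedTangent hΦ y).2 (X (restrictedLegendre hk L y))
  obtain ⟨z, hz⟩ := (bijective_restrictedTangent hΦ y).2 (Z (restrictedLegendre hk L y))
  have h1 : ∀ (Y : ∀ a : RestrictedJet n π (k - 1), TangentSpace (restrictedModel n (k - 1)) a)
      (_ : IsHamiltonianSolution hk L Y) (v : JetCoord n (2 * k - 1)),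
      restrictedTangent hk L y v = Y (restrictedLegendre hk L y) →
      (legendreTangent hk L y v).1.1 = 1 ∧
      ∀ u, (legendreTangent hk L y u).2 (legendreTangent hk L y v).1 -
        (legendreTangent hk L y v).2 (legendreTangent hk L y u).1 = 0 := by
    intro Y hY v hv
    refine ⟨?_, fun u => ?_⟩
    · have h2 := (mfderiv_time_restrictedJet _ _).symm.trans
        (hY.time (restrictedLegendre hk L y))
      rw [← hv, restrictedTangent_apply hF] at h2
      exact h2
    · rw [← hamiltonCartanForm_apply hΦ hF, hv]
      exact hY.contraction _ _
  obtain ⟨x0, x1⟩ := h1 X hX x hx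
  obtain ⟨z0, z1⟩ := h1 Z hZ z hz
  -- Both fields have `dt` component `1`, so their difference has none; surjectivity of `T FL`
  -- supplies the transversality hypothesis.
  have h2 : legendreTangent hk L y z - legendreTangent hk L y x = 0 := by
    refine eq_zero_of_forall_canonical_eq_zero (T := legendreTangent hk L y) (fun w => ?_) ?_ ?_
    · obtain ⟨u, hu⟩ := (bijective_restrictedTangent hΦ y).2 w
      rw [restrictedTangent_apply hF] at hu
      exact ⟨u, congrArg Prod.fst hu, congrArg Prod.snd hu⟩
    · simp [x0, z0]
    · intro u
      have h3 := x1 u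
      have h4 := z1 u
      simp only [Prod.fst_sub, Prod.snd_sub, map_sub, sub_apply]
      linarith
  rw [← hx, ← hz, restrictedTangent_apply hF, restrictedTangent_apply hF, sub_eq_zero.1 h2]

/-- The vector field along `W_1` determined by a vector field on `J^{2k-1} π`. -/
def graphField (hk : 1 ≤ k) (L : Jet n π k → ℝ)
    (v : Jet n π (2 * k - 1) → JetCoord n (2 * k - 1)) (w : JetMomentum n π k) :
    JetCoord n (2 * k - 1) × (JetCoord n (k - 1) × (JetCoord n (k - 1) →L[ℝ] ℝ)) :=
  (v w.1, legendreTangent hk L w.1 (v w.1))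

lemma isSmoothAlong_graphField
    (hF : ContMDiff 𝓘(ℝ, JetCoord n (2 * k - 1)) (cotangentModel n (k - 1)) ∞
      (extendedLegendre hk L))
    {v : Jet n π (2 * k - 1) → JetCoord n (2 * k - 1)} (hv : IsSmoothField v) :
    IsSmoothAlong (jetMomentumModel n k) (legendreGraph hk L) fun w => graphField hk L v w.1 := by
  refine ⟨graphField hk L v, ?_, fun _ => rfl⟩
  have hG : ContMDiff 𝓘(ℝ, JetCoord n (2 * k - 1)) (jetMomentumModel n k) ∞
      (fun y => (y, extendedLegendre hk L y)) := contMDiff_id.prodMk hF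
  -- The tangent map of `y ↦ (y, FL~(y))`, composed with `v` and the first projection, is smooth on
  -- the whole product; over `W_1` its base point is `w` itself, so there it is the required field.
  have h := ((hG.contMDiff_tangentMap (m := ∞) (by simp)).comp hv).comp
    (contMDiff_fst (I := 𝓘(ℝ, JetCoord n (2 * k - 1))) (J := cotangentModel n (k - 1))
      (M := Jet n π (2 * k - 1)) (N := CotangentJet n π (k - 1)))
  refine h.contMDiffOn.congr fun w hw => ?_
  have hw' : w.2 = extendedLegendre hk L w.1 := hw
  refine Bundle.TotalSpace.ext (Prod.ext rfl hw') (heq_of_eq ?_)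
  exact (mfderiv_graph_apply (mdifferentiableAt_extendedLegendre hF w.1) (v w.1)).symm

/-- The hypothesis tests only vectors tangent to `W_1`, the conclusion all those tangent to `W_o`;
the passage uses surjectivity of `T FL` and `snd_eq_of_mfderiv_quotientMap_eq`. -/
lemma isUnifiedSolution_graphField (hL : ContMDiff 𝓘(ℝ, JetCoord n k) 𝓘(ℝ, ℝ) ∞ L)
    (hΦ : ⇑Φ = restrictedLegendre hk L)
    (hF : ContMDiff 𝓘(ℝ, JetCoord n (2 * k - 1)) (cotangentModel n (k - 1)) ∞
      (extendedLegendre hk L))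
    {v : Jet n π (2 * k - 1) → JetCoord n (2 * k - 1)} (hv : IsSmoothField v)
    (h0 : ∀ y, (v y).1 = 1)
    (h1 : ∀ y u, (legendreTangent hk L y u).2 (legendreTangent hk L y (v y)).1 -
      (legendreTangent hk L y (v y)).2 (legendreTangent hk L y u).1 = 0) :
    IsUnifiedSolution hk L fun w => graphField hk L v w.1 := by
  refine ⟨isSmoothAlong_graphField hF hv, ?_, ?_, ?_⟩
  · rintro ⟨⟨y, α⟩, h⟩
    obtain rfl : α = extendedLegendre hk L y := h
    exact graph_mem_tangentSet hF y (v y)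
  · rintro ⟨⟨y, α⟩, h⟩ u hu
    obtain rfl : α = extendedLegendre hk L y := h
    -- The vector tangent to `W_1` generated by `x` has the same image under `Tμ ∘ Tρ_2` as `u`,
    -- hence the same component in `T*(J^{k-1} π)`, the only one the form sees.
    obtain ⟨x, hx⟩ := (bijective_restrictedTangent hΦ y).2
      (u.2.1, u.2.2.comp (ContinuousLinearMap.inr ℝ ℝ (Fin (k - 1 + 1) → Fin n → ℝ)))
    rw [restrictedTangent_apply hF] at hx
    have h2 := snd_eq_of_mfderiv_quotientMap_eq hL hu (graph_mem_tangentSet hF y x)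
      (congrArg Prod.fst hx).symm (congrArg Prod.snd hx).symm
    refine (unifiedForm_apply _ _ _).trans ?_
    rw [h2]
    exact h1 y x
  · rintro ⟨⟨y, α⟩, h⟩
    exact (mfderiv_time_jetMomentum _ _).trans (h0 y)

/-- The vector field on `J^{2k-1} π` determined by a vector field along `W_1`. -/
def baseField
    (X : ∀ w : legendreGraph hk L, TangentSpace (jetMomentumModel n k) (w : JetMomentum n π k))
    (y : Jet n π (2 * k - 1)) : JetCoord n (2 * k - 1) :=
  (X ⟨(y, extendedLegendre hk L y), rfl⟩).1

lemma eq_graphField_baseField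
    (hF : ContMDiff 𝓘(ℝ, JetCoord n (2 * k - 1)) (cotangentModel n (k - 1)) ∞
      (extendedLegendre hk L))
    {X : ∀ w : legendreGraph hk L, TangentSpace (jetMomentumModel n k) (w : JetMomentum n π k)}
    (hX : IsTangentToGraph hk L X) (w : legendreGraph hk L) :
    X w = graphField hk L (baseField X) w.1 := by
  obtain ⟨⟨y, α⟩, h⟩ := w
  obtain rfl : α = extendedLegendre hk L y := h
  exact Prod.ext rfl (snd_eq_of_mem_tangentSet_legendreGraph hF
    (hX ⟨(y, extendedLegendre hk L y), rfl⟩))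

lemma isSmoothField_baseField
    (hF : ContMDiff 𝓘(ℝ, JetCoord n (2 * k - 1)) (cotangentModel n (k - 1)) ∞
      (extendedLegendre hk L))
    {X : ∀ w : legendreGraph hk L, TangentSpace (jetMomentumModel n k) (w : JetMomentum n π k)}
    (hX : IsSmoothAlong (jetMomentumModel n k) (legendreGraph hk L) X) :
    IsSmoothField (baseField X) := by
  obtain ⟨Y, hY, hYX⟩ := hX
  have hG : ContMDiff 𝓘(ℝ, JetCoord n (2 * k - 1)) (jetMomentumModel n k) ∞
      (fun y => (y, extendedLegendre hk L y)) := contMDiff_id.prodMk hF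
  have h1 := hY.comp_contMDiff hG (fun y => rfl)
  have h2 := ((contMDiff_fst (I := 𝓘(ℝ, JetCoord n (2 * k - 1))) (J := cotangentModel n (k - 1))
      (M := Jet n π (2 * k - 1)) (N := CotangentJet n π (k - 1))
      (n := ∞)).contMDiff_tangentMap (m := ∞) (by simp)).comp h1
  refine h2.congr fun y => ?_
  refine Bundle.TotalSpace.ext rfl (heq_of_eq ?_)
  change (X ⟨(y, extendedLegendre hk L y), rfl⟩).1 = mfderiv (jetMomentumModel n k)
    𝓘(ℝ, JetCoord n (2 * k - 1)) Prod.fst (y, extendedLegendre hk L y) (Y _)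
  rw [mfderiv_fst, ← hYX]
  rfl

/-- The pull-back of a vector field by the restricted Legendre–Ostrogradsky map. -/
def pullField (Φ : Diffeomorph 𝓘(ℝ, JetCoord n (2 * k - 1)) (restrictedModel n (k - 1))
      (Jet n π (2 * k - 1)) (RestrictedJet n π (k - 1)) ∞)
    (X : ∀ a : RestrictedJet n π (k - 1), TangentSpace (restrictedModel n (k - 1)) a)
    (y : Jet n π (2 * k - 1)) : JetCoord n (2 * k - 1) :=
  mfderiv (restrictedModel n (k - 1)) 𝓘(ℝ, JetCoord n (2 * k - 1)) Φ.symm (Φ y) (X (Φ y))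

lemma isSmoothField_pullField
    {X : ∀ a : RestrictedJet n π (k - 1), TangentSpace (restrictedModel n (k - 1)) a}
    (hX : ContMDiff (restrictedModel n (k - 1)) (restrictedModel n (k - 1)).tangent ∞
      (fun a => (⟨a, X a⟩ :
        TangentBundle (restrictedModel n (k - 1)) (RestrictedJet n π (k - 1))))) :
    IsSmoothField (pullField Φ X) := by
  have h := ((Φ.symm.contMDiff.contMDiff_tangentMap (m := ∞) (by simp)).comp hX).comp Φ.contMDiff
  refine h.congr fun y => ?_
  exact Bundle.TotalSpace.ext (Φ.symm_apply_apply y).symm (heq_of_eq rfl)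

lemma restrictedTangent_pullField (hΦ : ⇑Φ = restrictedLegendre hk L)
    (X : ∀ a : RestrictedJet n π (k - 1), TangentSpace (restrictedModel n (k - 1)) a)
    (y : Jet n π (2 * k - 1)) :
    restrictedTangent hk L y (pullField Φ X y) = X (restrictedLegendre hk L y) := by
  have h1 := mfderiv_comp (Φ y) (Φ.contMDiff.contMDiffAt.mdifferentiableAt (by simp))
    (Φ.symm.contMDiff.contMDiffAt.mdifferentiableAt (by simp) (x := Φ y))
  have h2 := DFunLike.congr_fun h1 (X (Φ y))
  have h3 : restrictedTangent hk L y (pullField Φ X y) =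
      mfderiv 𝓘(ℝ, JetCoord n (2 * k - 1)) (restrictedModel n (k - 1)) Φ (Φ.symm (Φ y))
        (pullField Φ X y) :=
    mfderiv_apply_congr (V := JetCoord n (2 * k - 1))
      (V' := JetCoord n (k - 1) × ((Fin (k - 1 + 1) → Fin n → ℝ) →L[ℝ] ℝ)) hΦ.symm
      (Φ.symm_apply_apply y).symm _
  refine h3.trans (h2.symm.trans ?_)
  have h4 : (mfderiv (restrictedModel n (k - 1)) (restrictedModel n (k - 1)) (Φ ∘ Φ.symm) (Φ y)
      (X (Φ y)) : JetCoord n (k - 1) × ((Fin (k - 1 + 1) → Fin n → ℝ) →L[ℝ] ℝ)) =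
      mfderiv (restrictedModel n (k - 1)) (restrictedModel n (k - 1)) id (Φ y) (X (Φ y)) :=
    mfderiv_apply_congr
      (V := JetCoord n (k - 1) × ((Fin (k - 1 + 1) → Fin n → ℝ) →L[ℝ] ℝ))
      (V' := JetCoord n (k - 1) × ((Fin (k - 1 + 1) → Fin n → ℝ) →L[ℝ] ℝ))
      (funext fun a => Φ.apply_symm_apply a) rfl _
  refine h4.trans ?_
  rw [mfderiv_id, ← hΦ]
  rfl

/-- On `W_1` the map `ρ̂_2` is `FL` in the graph parametrization, so projecting `X_o` amounts to
pushing its base field forward by `FL`. -/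
lemma isProjectedTo_iff
    (hF : ContMDiff 𝓘(ℝ, JetCoord n (2 * k - 1)) (cotangentModel n (k - 1)) ∞
      (extendedLegendre hk L))
    {Xo : ∀ w : legendreGraph hk L, TangentSpace (jetMomentumModel n k) (w : JetMomentum n π k)}
    (ho : IsTangentToGraph hk L Xo)
    (Xh : ∀ a : RestrictedJet n π (k - 1), TangentSpace (restrictedModel n (k - 1)) a) :
    IsProjectedTo hk L Xo Xh ↔
      ∀ y, Xh (restrictedLegendre hk L y) = restrictedTangent hk L y (baseField Xo y) := by
  have h1 : ∀ y, mfderiv (jetMomentumModel n k) (restrictedModel n (k - 1))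
      (toRestricted : JetMomentum n π k → RestrictedJet n π (k - 1)) (y, extendedLegendre hk L y)
        (Xo ⟨(y, extendedLegendre hk L y), rfl⟩) =
        restrictedTangent hk L y (baseField Xo y) := by
    intro y
    rw [eq_graphField_baseField hF ho]
    refine (mfderiv_toRestricted _ _).trans ?_
    rw [restrictedTangent_apply hF]
    rfl
  constructor
  · intro h y
    rw [← h1]
    exact h ⟨(y, extendedLegendre hk L y), rfl⟩
  · rintro h ⟨⟨y, α⟩, hw⟩
    obtain rfl : α = extendedLegendre hk L y := hw
    exact (h y).trans (h1 y).symm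

end VectorFields

end HOMech

end

/-! ### The equivalence of the unified and Hamiltonian equations -/

theorem mainTheorem4 {n : ℕ} {E : Type*} [TopologicalSpace E] [T2Space E]
    [SecondCountableTopology E] [ChartedSpace (EuclideanSpace ℝ (Fin (n + 1))) E]
    [IsManifold (𝓡 (n + 1)) ∞ E] (π : E → ℝ) [HOMech.IsFibredOverLine n π] {k : ℕ} (hk : 1 ≤ k)
    (L : HOMech.Jet n π k → ℝ) (hL : ContMDiff 𝓘(ℝ, HOMech.JetCoord n k) 𝓘(ℝ, ℝ) ∞ L)
    (hreg : HOMech.IsHyperregular hk L) :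
    (∀ Xo, HOMech.IsUnifiedSolution hk L Xo → HOMech.IsTangentToGraph hk L Xo →
      ∃ Xh, HOMech.IsHamiltonianSolution hk L Xh ∧ HOMech.IsProjectedTo hk L Xo Xh ∧
        ∀ Z, HOMech.IsHamiltonianSolution hk L Z → Z = Xh) ∧
    (∀ Xh, HOMech.IsHamiltonianSolution hk L Xh →
      ∃ Xo, HOMech.IsUnifiedSolution hk L Xo ∧ HOMech.IsTangentToGraph hk L Xo ∧
        HOMech.IsProjectedTo hk L Xo Xh ∧
        ∀ Z, HOMech.IsUnifiedSolution hk L Z → HOMech.IsTangentToGraph hk L Z → Z = Xo) := by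
  open HOMech in
  obtain ⟨Φ, hΦ⟩ := hreg
  have hF : ContMDiff 𝓘(ℝ, JetCoord n (2 * k - 1)) (cotangentModel n (k - 1)) ∞
      (extendedLegendre hk L) := contMDiff_extendedLegendre hk L hL (hΦ ▸ Φ.contMDiff)
  have part1 : ∀ Xo, IsUnifiedSolution hk L Xo → IsTangentToGraph hk L Xo →
      ∃ Xh, IsHamiltonianSolution hk L Xh ∧ IsProjectedTo hk L Xo Xh ∧
        ∀ Z, IsHamiltonianSolution hk L Z → Z = Xh := by
    intro Xo hXo ht
    have hs := isHamiltonianSolution_pushField hL hΦ hF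
      (isSmoothField_baseField hF hXo.smooth) (fun y => ?_) (fun y u => ?_)
    · exact ⟨_, hs, (isProjectedTo_iff hF ht _).2 (pushField_apply hΦ _),
        fun Z hZ => eq_of_hamiltonian hΦ hF hs hZ⟩
    · exact (mfderiv_time_jetMomentum _ _).symm.trans
        (hXo.time ⟨(y, extendedLegendre hk L y), rfl⟩)
    -- Vectors tangent to `W_1` are tangent to `W_o`, so in this direction the contraction is merely
    -- restricted.
    · have h := hXo.contraction ⟨(y, extendedLegendre hk L y), rfl⟩ _
        (graph_mem_tangentSet hF y u)
      rw [eq_graphField_baseField hF ht] at h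
      exact (unifiedForm_apply _ _ _).symm.trans h
  refine ⟨part1, fun Xh hXh => ?_⟩
  have hp := restrictedTangent_pullField hΦ Xh
  have hv := isSmoothField_pullField (Φ := Φ) hXh.smooth
  have hT : IsTangentToGraph hk L fun w => graphField hk L (pullField Φ Xh) w.1 := by
    rintro ⟨⟨y, α⟩, h⟩
    obtain rfl : α = extendedLegendre hk L y := h
    exact mem_tangentSet_legendreGraph hF y _
  refine ⟨fun w => graphField hk L (pullField Φ Xh) w.1,
    isUnifiedSolution_graphField hL hΦ hF hv (fun y => ?_) (fun y u => ?_), hT,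
    (isProjectedTo_iff hF hT _).2 fun y => (hp y).symm, fun Z hZ hZt => ?_⟩
  · have h := (mfderiv_time_restrictedJet _ _).symm.trans (hXh.time (restrictedLegendre hk L y))
    rw [← hp y, restrictedTangent_apply hF, legendreTangent_time hL hF] at h
    exact h
  · rw [← hamiltonCartanForm_apply hΦ hF, hp]
    exact hXh.contraction _ _
  -- Uniqueness of `X_o`: by the first part `Z` projects to a Hamiltonian solution, which must be
  -- `Xh`; injectivity of `T FL` then fixes its base field, and tangency to `W_1` the rest.
  · obtain ⟨Y, hY, hZY, -⟩ := part1 Z hZ hZt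
    obtain rfl : Y = Xh := eq_of_hamiltonian hΦ hF hXh hY
    have h1 : baseField Z = pullField Φ Y := by
      funext y
      refine (bijective_restrictedTangent hΦ y).1 ?_
      rw [hp y]
      exact ((isProjectedTo_iff hF hZt _).1 hZY y).symm
    funext w
    rw [eq_graphField_baseField hF hZt w, h1]
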